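/- Fix integers $m\ge 2$, $r\ge 2$ and $\ell(1),\dots,\ell(r)\ge 2$ with $\ell(i)\ne\ell(j)$ for $i\ne j$. For $n\ge 1$ let $G^m_n$ be the uniform attachment graph: the random multigraph on the vertices $1,\dots,n$ in which every vertex $j\in\{2,\dots,n\}$ has $m$ edges, labelled $1,\dots,m$, to vertices in $\{1,\dots,j-1\}$, all these $m(n-1)$ endpoints being chosen independently and uniformly at random. Let $W^{(i)}_n$ be the number of subgraphs of $G^m_n$ that are cycles of length $\ell(i)$ (edge directions are ignored, parallel edges are distinguished, and a pair of parallel edges is a $2$-cycle), and let $\mu_{n,i}:=\mathbb{E}\,W^{(i)}_n$. Then there is a positive constant $C$, depending only on $m$ and $\ell(1),\dots,\ell(r)$, such that for all $n\ge 3$ $$d_{\mathrm{TV}}\Big(\mathcal{L}\big((W^{(i)}_n)_{i=1}^r\big),\ \prod_{i=1}^r\mathrm{Po}(\mu_{n,i})\Big)\le \frac{C\log\log n}{\log n},$$ where $d_{\mathrm{TV}}(\nu_1,\nu_2)=\sup_A|\nu_1(A)-\nu_2(A)|$ is the total variation distance, the supremum being over all sets $A$ of $r$-tuples of non-negative integers,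 and $\mathrm{Po}(\mu)$ is the Poisson distribution with mean $\mu$. -/

import Mathlib

open MeasureTheory ProbabilityTheory

noncomputable section

/-- The total variation distance `sup_A |μ(A) - ν(A)|`, over measurable sets `A`. -/
def tvDist {S : Type*} [MeasurableSpace S] (μ ν : Measure S) : ℝ :=
  ⨆ A : {A : Set S // MeasurableSet A}, |μ.real A.1 - ν.real A.1|

/-- In a multigraph with vertex type `V`, edge type `E` and endpoint map `ends`, the set of edges
`F` is the edge set of an `ℓ`-cycle (`ℓ ≥ 2`): there are `ℓ` distinct vertices
`v 0, …, v (ℓ - 1)`, indexed cyclically, and `ℓ` distinct edges, the `i`-th one joining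
`v i` and `v (i + 1)`, which are exactly the elements of `F`. In particular, a `2`-cycle is a pair
of parallel edges. A cycle, as a subgraph, is determined by its edge set. -/
def IsCycleEdgeSet {V E : Type*} (ends : E → Sym2 V) (ℓ : ℕ) (F : Finset E) : Prop :=
  ∃ (v : ZMod ℓ → V) (e : ZMod ℓ → E), Function.Injective v ∧ Function.Injective e ∧
    (∀ i, ends (e i) = s(v i, v (i + 1))) ∧ Set.range e = (F : Set E)

namespace UniformAttachment

/-- The half-edges `j^(a)`: the vertex `j` is not the first one, and `a` is one of its `m` edge
labels. The vertices `1, …, n` are represented by the elements `0, …, n - 1` of `Fin n`. -/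
abbrev HalfEdge (m n : ℕ) : Type := {j : Fin n // 0 < j.val} × Fin m

/-- The edges `ji^(a)`, `i < j`, of the `m`-fold complete multigraph: a half-edge `j^(a)` together
with an earlier vertex `i`. -/
abbrev Edge (m n : ℕ) : Type := Σ h : HalfEdge m n, Fin h.1.1.val

/-- The two endpoints `j` and `i` of the edge `ji^(a)`. -/
def ends {m n : ℕ} (x : Edge m n) : Sym2 (Fin n) :=
  s(x.1.1.1, Fin.castLE x.1.1.1.isLt.le x.2)

/-- The outcomes of the attachment procedure: every half-edge `j^(a)` chooses a vertex
`i < j`. -/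
abbrev Outcome (m n : ℕ) : Type := (h : HalfEdge m n) → Fin h.1.1.val

/-- The law of the attachment procedure: all the choices are independent, and the choice of
`j^(a)` is uniformly distributed on the vertices `i < j`. -/
def law (m n : ℕ) : Measure (Outcome m n) :=
  Measure.pi fun _ => uniformOn Set.univ

/-- The edge set of the graph `G^m_n`, as a set of edges of the `m`-fold complete multigraph. -/
def edgeSet {m n : ℕ} (ω : Outcome m n) : Set (Edge m n) :=
  {x | ω x.1 = x.2}

/-- The number of `ℓ`-cycles in the graph `G^m_n`. -/
def cycleCount (m n ℓ : ℕ) (ω : Outcome m n) : ℕ :=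
  Set.ncard {F : Finset (Edge m n) | IsCycleEdgeSet ends ℓ F ∧ (F : Set (Edge m n)) ⊆ edgeSet ω}

/-- The expected number of `ℓ`-cycles in `G^m_n`. -/
def cycleMean (m n ℓ : ℕ) : NNReal :=
  ⟨∫ ω, (cycleCount m n ℓ ω : ℝ) ∂(law m n), integral_nonneg fun _ => Nat.cast_nonneg _⟩

end UniformAttachment

end

/-! ### Poisson semigroups of contractions in commutative Banach algebras. -/

section BanachAlgebra

/-! Let `τ i` be the shift by the `i`-th unit vector, acting on bounded functions on `ℕ^r`. The law
of the counts is encoded by `E ∏ (1 + I α (τ (κ α) - 1))`, where `I α` is the indicator that the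
cycle `α` is present and `κ α` is the index of its length. The Poisson law is encoded by `exp (∑ μ i
(τ i - 1))`. The norm of the difference bounds the total variation distance.

The two are joined by the path in `s ∈ [0, 1]` that keeps each cycle with probability `1 - s` and
adds independent Poisson variables of means `s μ i`. The neighbours of `α` are the cycles sharing a
half-edge with it; `α` is independent of all others. In the derivative the first-order terms
therefore cancel, leaving second differences `(τ i - 1)(τ j - 1)` times the Poisson semigroup at
time `s`. Their total coefficient is at most `B`, the sum of `p α p β` over neighbouring pairs and
of `E (I α I β)` over distinct neighbouring pairs. If all `μ i ≥ M`, a second difference has norm at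
most `min 4 (2 / (s M))`, so integrating gives `B (4 + 2 log M) / M`
(`norm_expectation_thinnedProd_sub_exp_le`).

It remains to bound `B` uniformly in `n` and to take `M` of order `log n`. An edge `xy` has
probability of order `1 / max x y`, a kernel for which `1 / √x` is almost an eigenfunction. Hence
the cycles through `z` have total weight `O(1 / z)`, and, given `α`, the other cycles sharing an
edge with it have conditional weight `O(∑ 1 / z)` over the vertices `z` of `α`. Summing over `α`
yields `B = O(∑ 1 / z²) = O(1)` (`sum_weight_mul_invSum_le`, `sum_joint_present_le`). Cycles through
decreasing vertex sequences already give means of order `log n` (`log_le_cycleMean`). -/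

theorem norm_pow_le_one_of_norm_le_one {A : Type*} [NormedRing A] [NormOneClass A] {τ : A}
    (hτ : ‖τ‖ ≤ 1) (k : ℕ) : ‖τ ^ k‖ ≤ 1 :=
  (norm_pow_le τ k).trans (pow_le_one₀ (norm_nonneg _) hτ)

theorem norm_sub_one_le_two {A : Type*} [NormedRing A] [NormOneClass A] {τ : A} (hτ : ‖τ‖ ≤ 1) :
    ‖τ - 1‖ ≤ 2 :=
  (norm_sub_le _ _).trans (by rw [norm_one]; linarith)

/-- A telescoping bound for products of contractions. -/
theorem norm_prod_one_add_sub_one_mul_le {A : Type*} [NormedCommRing A] [NormOneClass A]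
    {Γ : Type*} (S : Finset Γ) (x : Γ → A) (hx : ∀ β ∈ S, ‖1 + x β‖ ≤ 1) (z : A) :
    ‖(∏ β ∈ S, (1 + x β) - 1) * z‖ ≤ ∑ β ∈ S, ‖x β * z‖ := by
  classical
  induction S using Finset.induction_on with
  | empty => simp
  | insert a S ha ih =>
    rw [Finset.prod_insert ha, Finset.sum_insert ha]
    have hS : ‖∏ β ∈ S, (1 + x β)‖ ≤ 1 := (Finset.norm_prod_le _ _).trans
      (Finset.prod_le_one (fun _ _ => norm_nonneg _) fun β hβ => hx β (Finset.mem_insert_of_mem hβ))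
    calc _ = ‖x a * z * ∏ β ∈ S, (1 + x β) + (∏ β ∈ S, (1 + x β) - 1) * z‖ := by
          congr 1; ring
      _ ≤ ‖x a * z‖ * 1 + ∑ β ∈ S, ‖x β * z‖ := by
          refine (norm_add_le _ _).trans (add_le_add ?_ (ih fun β hβ => hx β (Finset.mem_insert_of_mem hβ)))
          exact (norm_mul_le _ _).trans (by gcongr)
      _ = _ := by rw [mul_one]

theorem hasSum_of_eq {E : Type*} [AddCommMonoid E] [TopologicalSpace E] {f g : ℕ → E} {a b : E}
    (h : HasSum f a) (hf : ∀ k, g k = f k) (hab : b = a) : HasSum g b := by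
  rw [funext hf, hab]; exact h

variable {A : Type*} [NormedCommRing A] [NormedAlgebra ℝ A] [CompleteSpace A]

theorem exp_add_of_real (x y : A) :
    NormedSpace.exp (x + y) = NormedSpace.exp x * NormedSpace.exp y :=
  letI : NormedAlgebra ℚ A := NormedAlgebra.restrictScalars ℚ ℝ A
  NormedSpace.exp_add

theorem exp_sum_of_real {ι : Type*} (s : Finset ι) (f : ι → A) :
    NormedSpace.exp (∑ i ∈ s, f i) = ∏ i ∈ s, NormedSpace.exp (f i) :=
  letI : NormedAlgebra ℚ A := NormedAlgebra.restrictScalars ℚ ℝ A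
  NormedSpace.exp_sum s f

/-- The power series of `exp (t (τ - 1))`, whose coefficients are the Poisson weights. -/
theorem hasSum_exp_smul_sub_one (τ : A) (t : ℝ) :
    HasSum (fun k : ℕ => (Real.exp (-t) * t ^ k / k.factorial) • τ ^ k)
      (NormedSpace.exp (t • (τ - 1))) := by
  have h1 := NormedSpace.exp_series_hasSum_exp' (𝕂 := ℝ) (t • τ)
  have h2 : NormedSpace.exp (t • (τ - 1)) = Real.exp (-t) • NormedSpace.exp (t • τ) := by
    have h3 : t • (τ - 1) = t • τ + algebraMap ℝ A (-t) := by
      rw [Algebra.algebraMap_eq_smul_one, smul_sub, neg_smul, sub_eq_add_neg]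
    rw [h3, exp_add_of_real, ← NormedSpace.algebraMap_exp_comm, ← Real.exp_eq_exp_ℝ, mul_comm,
      ← Algebra.smul_def]
  rw [h2]
  convert h1.const_smul (Real.exp (-t)) using 2 with k
  rw [smul_pow, smul_smul, smul_smul]
  congr 1
  ring

theorem hasSum_poissonWeight (t : ℝ) :
    HasSum (fun k : ℕ => Real.exp (-t) * t ^ k / k.factorial) 1 := by
  simpa using hasSum_exp_smul_sub_one (1 : ℝ) t

/-- The Stein identity `E[N f(N)] = t E[f(N + 1)]` for `N ~ Po(t)`, from `k t^k / k! = t t^(k-1) /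
(k-1)!`. -/
theorem hasSum_poissonWeight_mul_smul {E : Type*} [NormedAddCommGroup E] [NormedSpace ℝ E]
    (t : ℝ) (f : ℕ → E) (a : E)
    (h : HasSum (fun k : ℕ => (Real.exp (-t) * t ^ k / k.factorial) • f (k + 1)) a) :
    HasSum (fun k : ℕ => (Real.exp (-t) * t ^ k / k.factorial * k) • f k) (t • a) := by
  rw [← hasSum_nat_add_iff' 1]
  simp only [Finset.range_one, Finset.sum_singleton, Nat.cast_zero, zero_smul, mul_zero, sub_zero]
  convert h.const_smul t using 2 with k
  rw [smul_smul, Nat.factorial_succ]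
  congr 1
  push_cast
  field_simp
  ring

/-- The variance of `N / t`; both moments come from the Stein identity. -/
theorem hasSum_poissonWeight_mul_sq {t : ℝ} (ht : 0 < t) :
    HasSum (fun k : ℕ => Real.exp (-t) * t ^ k / k.factorial * (k / t - 1) ^ 2) (1 / t) := by
  have h0 := hasSum_poissonWeight t
  have h1 := hasSum_poissonWeight_mul_smul t (fun _ => (1 : ℝ)) 1 (by simpa using h0)
  have h2 := hasSum_poissonWeight_mul_smul t (fun k => (k : ℝ)) (t + 1) (by
    refine hasSum_of_eq (h1.add h0) (fun k => ?_) (by simp)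
    push_cast; simp only [smul_eq_mul]; ring)
  refine hasSum_of_eq (((h2.mul_left (1 / t ^ 2)).sub (h1.mul_left (2 / t))).add h0)
    (fun k => ?_) ?_
  · simp only [smul_eq_mul]; field_simp; ring
  · simp only [smul_eq_mul]; field_simp; ring

/-- A Poisson mixture of the contractions `τ ^ k` is a contraction. -/
theorem norm_exp_smul_sub_one_le [NormOneClass A] {τ : A} (hτ : ‖τ‖ ≤ 1) {t : ℝ} (ht : 0 ≤ t) :
    ‖NormedSpace.exp (t • (τ - 1))‖ ≤ 1 := by
  rw [← (hasSum_exp_smul_sub_one τ t).tsum_eq]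
  refine tsum_of_norm_bounded (hasSum_poissonWeight t) fun k => ?_
  rw [norm_smul, Real.norm_of_nonneg (by positivity)]
  exact mul_le_of_le_one_right (by positivity) (norm_pow_le_one_of_norm_le_one hτ k)

/-- Smoothing by a Poisson variable: the total variation distance between `Po(t)` and `Po(t) + 1`
is of order `1 / √t`. -/
theorem norm_sub_one_mul_exp_le [NormOneClass A] {τ : A} (hτ : ‖τ‖ ≤ 1) {t : ℝ} (ht : 0 < t) :
    ‖(τ - 1) * NormedSpace.exp (t • (τ - 1))‖ ≤ 1 / √t := by
  have hs := hasSum_exp_smul_sub_one τ t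
  have h1 := hasSum_poissonWeight_mul_smul t (fun k => τ ^ k) (τ * NormedSpace.exp (t • (τ - 1))) (by
    refine hasSum_of_eq (hs.mul_left τ) (fun k => ?_) rfl
    rw [pow_succ', mul_smul_comm])
  -- By the Stein identity the element is `E[(N / t - 1) τ^N]`, so its norm is at most `E|N / t -
  -- 1|`.
  have h2 : HasSum (fun k : ℕ => (Real.exp (-t) * t ^ k / k.factorial * (k / t - 1)) • τ ^ k)
      ((τ - 1) * NormedSpace.exp (t • (τ - 1))) := by
    refine hasSum_of_eq ((h1.const_smul t⁻¹).sub hs) (fun k => ?_) ?_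
    · rw [smul_smul, ← sub_smul]; congr 1; field_simp
    · rw [smul_smul, inv_mul_cancel₀ ht.ne', one_smul, sub_mul, one_mul]
  rw [← h2.tsum_eq]
  have hst : 0 < √t := Real.sqrt_pos.2 ht
  have h3 := (((hasSum_poissonWeight_mul_sq ht).mul_left (√t)).add
    ((hasSum_poissonWeight t).mul_left (1 / √t))).mul_left (1 / 2)
  have h4 : 1 / 2 * (√t * (1 / t) + 1 / √t * 1) = 1 / √t := by
    nth_rewrite 2 [← Real.mul_self_sqrt ht.le]
    field_simp; norm_num
  rw [h4] at h3
  refine tsum_of_norm_bounded h3 fun k => ?_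
  rw [norm_smul]
  refine (mul_le_of_le_one_right (norm_nonneg _) (norm_pow_le_one_of_norm_le_one hτ k)).trans ?_
  rw [norm_mul, Real.norm_of_nonneg (by positivity : 0 ≤ Real.exp (-t) * t ^ k / k.factorial)]
  have hp : 0 ≤ Real.exp (-t) * t ^ k / k.factorial := by positivity
  generalize Real.exp (-t) * t ^ k / k.factorial = p at *
  -- A pointwise AM-GM in place of Cauchy–Schwarz; with variance `1 / t` its mean is exactly `1 /
  -- √t`.
  have key : ‖(k : ℝ) / t - 1‖ ≤ 1 / 2 * (√t * (k / t - 1) ^ 2 + 1 / √t) := by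
    rw [Real.norm_eq_abs, ← sq_abs ((k : ℝ) / t - 1)]
    generalize |(k : ℝ) / t - 1| = y
    have : 0 ≤ (√t * y - 1) ^ 2 / √t := by positivity
    have e : (√t * y - 1) ^ 2 / √t = √t * y ^ 2 + 1 / √t - 2 * y := by
      field_simp; ring
    linarith
  calc p * ‖(k : ℝ) / t - 1‖ ≤ p * (1 / 2 * (√t * (k / t - 1) ^ 2 + 1 / √t)) :=
        mul_le_mul_of_nonneg_left key hp
    _ = _ := by ring

theorem norm_exp_sum_le_one [NormOneClass A] {ι : Type*} [Fintype ι] {τ : ι → A}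
    (hτ : ∀ i, ‖τ i‖ ≤ 1) {ν : ι → ℝ} (hν : ∀ i, 0 ≤ ν i) :
    ‖NormedSpace.exp (∑ i, ν i • (τ i - 1))‖ ≤ 1 := by
  rw [exp_sum_of_real]
  refine (Finset.norm_prod_le _ _).trans ?_
  exact Finset.prod_le_one (fun _ _ => norm_nonneg _)
    fun i _ => norm_exp_smul_sub_one_le (hτ i) (hν i)

/-- Second differences are smoothed by the product Poisson semigroup. -/
theorem norm_second_difference_mul_exp_le [NormOneClass A] {ι : Type*} [Fintype ι] {τ : ι → A}
    (hτ : ∀ i, ‖τ i‖ ≤ 1) {μ : ι → ℝ} {M : ℝ} (hM : 0 < M) (hμ : ∀ i, M ≤ μ i) (i j : ι) :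
    ‖(τ i - 1) * (τ j - 1) * NormedSpace.exp (∑ k, μ k • (τ k - 1))‖ ≤ 2 / M := by
  classical
  -- Each difference is smoothed by its own share `M / 2` of the mean; for `i = j` both shares come
  -- from the same coordinate. What is left has nonnegative means and is a contraction.
  have e : ∑ k, μ k • (τ k - 1) = (M / 2) • (τ i - 1) + (M / 2) • (τ j - 1) +
      ∑ k, (μ k - (if k = i then M / 2 else 0) - (if k = j then M / 2 else 0)) • (τ k - 1) := by
    simp only [sub_smul, Finset.sum_sub_distrib, ite_smul, zero_smul, Finset.sum_ite_eq',
      Finset.mem_univ, if_true]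
    abel
  rw [e, exp_add_of_real, exp_add_of_real]
  have hb := norm_exp_sum_le_one hτ
    (ν := fun k => μ k - (if k = i then M / 2 else 0) - (if k = j then M / 2 else 0)) (fun k => by
      have := hμ k
      split_ifs <;> linarith)
  generalize NormedSpace.exp (∑ k, (μ k - (if k = i then M / 2 else 0) -
    (if k = j then M / 2 else 0)) • (τ k - 1)) = R at hb
  have hi := norm_sub_one_mul_exp_le (hτ i) (half_pos hM)
  have hj := norm_sub_one_mul_exp_le (hτ j) (half_pos hM)
  have hsq : √(M / 2) * √(M / 2) = M / 2 := Real.mul_self_sqrt (half_pos hM).le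
  calc _ = ‖((τ i - 1) * NormedSpace.exp ((M / 2) • (τ i - 1))) *
        ((τ j - 1) * NormedSpace.exp ((M / 2) • (τ j - 1))) * R‖ := by congr 1; ring
    _ ≤ (1 / √(M / 2)) * (1 / √(M / 2)) * 1 := by
        refine (norm_mul_le _ _).trans ?_
        gcongr
        exact (norm_mul_le _ _).trans (by gcongr)
    _ = 2 / M := by
        rw [mul_one, div_mul_div_comm, hsq, one_mul]; field_simp

/-- Needed near `s = 0`, where the semigroup has not yet smoothed anything. -/
theorem norm_second_difference_mul_exp_le_four [NormOneClass A] {ι : Type*} [Fintype ι] {τ : ι → A}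
    (hτ : ∀ i, ‖τ i‖ ≤ 1) {μ : ι → ℝ} (hμ : ∀ i, 0 ≤ μ i) (i j : ι) :
    ‖(τ i - 1) * (τ j - 1) * NormedSpace.exp (∑ k, μ k • (τ k - 1))‖ ≤ 4 := by
  have hi := norm_sub_one_le_two (hτ i)
  have hj := norm_sub_one_le_two (hτ j)
  calc ‖(τ i - 1) * (τ j - 1) * NormedSpace.exp (∑ k, μ k • (τ k - 1))‖ ≤ 2 * 2 * 1 := by
        refine (norm_mul_le _ _).trans ?_
        gcongr
        · exact (norm_mul_le _ _).trans (by gcongr)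
        · exact norm_exp_sum_le_one hτ hμ
    _ = 4 := by norm_num

end BanachAlgebra

/-! ### Interpolation between locally dependent counts and the Poisson law. -/

section Interpolation

theorem norm_one_add_smul_sub_one_le {A : Type*} [NormedCommRing A] [NormedAlgebra ℝ A]
    [NormOneClass A] {τ : A} (hτ : ‖τ‖ ≤ 1) {c : ℝ} (h0 : 0 ≤ c) (h1 : c ≤ 1) :
    ‖1 + c • (τ - 1)‖ ≤ 1 := by
  have e : 1 + c • (τ - 1) = (1 - c) • (1 : A) + c • τ := by
    rw [smul_sub, sub_smul, one_smul]; abel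
  rw [e]
  refine (norm_add_le _ _).trans ?_
  rw [norm_smul, norm_smul, Real.norm_of_nonneg h0, Real.norm_of_nonneg (sub_nonneg.2 h1), norm_one]
  nlinarith [norm_nonneg τ]

/-- If the norm of the derivative on `[0, 1]` is at most `4 B` and at most `2 B / (s M)`, then the
increment is at most `B (4 + 2 log M) / M`. -/
theorem norm_sub_le_of_deriv_le {E : Type*} [NormedAddCommGroup E] [NormedSpace ℝ E] {G G' : ℝ → E}
    (hG : ∀ s, HasDerivAt G (G' s) s) {B M : ℝ} (hM : 1 ≤ M)
    (h4 : ∀ s, 0 ≤ s → s ≤ 1 → ‖G' s‖ ≤ B * 4)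
    (h2 : ∀ s, 0 < s → s ≤ 1 → ‖G' s‖ ≤ B * (2 / (s * M))) :
    ‖G 1 - G 0‖ ≤ B * (4 + 2 * Real.log M) / M := by
  have hM0 : 0 < M := by linarith
  have hM1 : 1 / M ≤ 1 := (div_le_one hM0).2 hM
  have hMp : 0 < 1 / M := by positivity
  -- The interval is cut at `1 / M`: the constant bound costs `4 B / M` below, and `2 B / (s M)`
  -- integrates to `2 B log M / M` above.
  have first : ‖G (1 / M) - G 0‖ ≤ B * 4 * ‖1 / M - 0‖ :=
    Convex.norm_image_sub_le_of_norm_hasDerivWithin_le (s := Set.Icc 0 (1 / M))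
      (fun x _ => (hG x).hasDerivWithinAt) (fun x hx => h4 x hx.1 (hx.2.trans hM1))
      (convex_Icc _ _) ⟨le_rfl, hMp.le⟩ ⟨hMp.le, le_rfl⟩
  rw [sub_zero, Real.norm_of_nonneg hMp.le] at first
  have second : ‖G 1 - G (1 / M)‖ ≤ 2 * B / M * (Real.log 1 + Real.log M) := by
    refine image_norm_le_of_norm_deriv_right_le_deriv_boundary'
      (f := fun x => G x - G (1 / M)) (f' := G') (a := 1 / M) (b := 1)
      (B := fun x => 2 * B / M * (Real.log x + Real.log M)) (B' := fun x => 2 * B / M * x⁻¹)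
      ?_ ?_ ?_ ?_ ?_ ?_ ⟨hM1, le_rfl⟩
    · exact fun x _ => ((hG x).sub_const _).continuousAt.continuousWithinAt
    · exact fun x _ => ((hG x).sub_const _).hasDerivWithinAt
    · simp
    · intro x hx
      have hx0 : x ≠ 0 := (hMp.trans_le hx.1).ne'
      exact (((Real.hasDerivAt_log hx0).add_const _).const_mul _).continuousAt.continuousWithinAt
    · intro x hx
      have hx0 : x ≠ 0 := (hMp.trans_le hx.1).ne'
      exact (((Real.hasDerivAt_log hx0).add_const _).const_mul _).hasDerivWithinAt
    · intro x hx
      have hx0 : 0 < x := hMp.trans_le hx.1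
      refine (h2 x hx0 hx.2.le).trans (le_of_eq ?_)
      field_simp
  calc ‖G 1 - G 0‖ = ‖(G 1 - G (1 / M)) + (G (1 / M) - G 0)‖ := by congr 1; abel
    _ ≤ 2 * B / M * (Real.log 1 + Real.log M) + B * 4 * (1 / M) :=
        (norm_add_le _ _).trans (add_le_add second first)
    _ = _ := by rw [Real.log_one]; field_simp; ring

variable {A : Type*} [NormedCommRing A] [NormedAlgebra ℝ A] {Ω Γ ι : Type*}

/-- The generating product of the indicators `I β`, `β ∈ S`, thinned with retention
probability `c`. -/
def thinnedProd (κ : Γ → ι) (τ : ι → A) (I : Γ → Ω → ℝ) (c : ℝ) (S : Finset Γ) (ω : Ω) : A :=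
  ∏ β ∈ S, (1 + (c * I β ω) • (τ (κ β) - 1))

theorem norm_thinnedProd_le [NormOneClass A] (κ : Γ → ι) {τ : ι → A} (hτ : ∀ i, ‖τ i‖ ≤ 1) {I : Γ → Ω → ℝ}
    (hI0 : ∀ α ω, 0 ≤ I α ω) (hI1 : ∀ α ω, I α ω ≤ 1) {c : ℝ} (hc0 : 0 ≤ c) (hc1 : c ≤ 1)
    (S : Finset Γ) (ω : Ω) : ‖thinnedProd κ τ I c S ω‖ ≤ 1 :=
  (Finset.norm_prod_le _ _).trans (Finset.prod_le_one (fun _ _ => norm_nonneg _) fun _ _ =>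
    norm_one_add_smul_sub_one_le (hτ _) (mul_nonneg hc0 (hI0 _ _))
      (mul_le_one₀ hc1 (hI0 _ _) (hI1 _ _)))

/-- Telescoping over `S` releases one factor `c I β (τ (κ β) - 1)` at a time; with `τ i - 1` it
forms a second difference, and the remaining factors are contractions. -/
theorem norm_thinnedProd_union_sub_le [NormOneClass A] [DecidableEq Γ] (κ : Γ → ι) {τ : ι → A} (hτ : ∀ i, ‖τ i‖ ≤ 1)
    {I : Γ → Ω → ℝ} (hI0 : ∀ α ω, 0 ≤ I α ω) (hI1 : ∀ α ω, I α ω ≤ 1) {c : ℝ} (hc0 : 0 ≤ c)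
    (hc1 : c ≤ 1) {S T : Finset Γ} (hST : Disjoint S T) {z : A} (i : ι) {K : ℝ}
    (hK : ∀ j, ‖(τ i - 1) * (τ j - 1) * z‖ ≤ K) (ω : Ω) :
    ‖(τ i - 1) * (thinnedProd κ τ I c (S ∪ T) ω - thinnedProd κ τ I c T ω) * z‖ ≤
      ∑ β ∈ S, I β ω * K := by
  have e : (τ i - 1) * (thinnedProd κ τ I c (S ∪ T) ω - thinnedProd κ τ I c T ω) * z =
      (∏ β ∈ S, (1 + (c * I β ω) • (τ (κ β) - 1)) - 1) *
        (thinnedProd κ τ I c T ω * (τ i - 1) * z) := by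
    simp only [thinnedProd]
    rw [Finset.prod_union hST]; ring
  rw [e]
  refine (norm_prod_one_add_sub_one_mul_le S _ (fun β _ => norm_one_add_smul_sub_one_le (hτ _)
    (mul_nonneg hc0 (hI0 _ _)) (mul_le_one₀ hc1 (hI0 _ _) (hI1 _ _))) _).trans
      (Finset.sum_le_sum fun β _ => ?_)
  have hK0 : 0 ≤ K := (norm_nonneg _).trans (hK i)
  have hcI : 0 ≤ c * I β ω := mul_nonneg hc0 (hI0 _ _)
  calc _ = ‖(c * I β ω) • (thinnedProd κ τ I c T ω * ((τ i - 1) * (τ (κ β) - 1) * z))‖ := by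
        rw [smul_mul_assoc]; congr 2; ring
    _ ≤ (c * I β ω) * (1 * K) := by
        rw [norm_smul, Real.norm_of_nonneg hcI]
        refine mul_le_mul_of_nonneg_left ((norm_mul_le _ _).trans ?_) hcI
        exact mul_le_mul (norm_thinnedProd_le κ hτ hI0 hI1 hc0 hc1 _ _) (hK _) (norm_nonneg _)
          zero_le_one
    _ ≤ I β ω * K := by
        rw [one_mul]
        exact mul_le_mul_of_nonneg_right (mul_le_of_le_one_left (hI0 _ _) hc1) hK0

variable [Fintype Ω] [Fintype Γ] [DecidableEq Γ]

/-- The derivative of the interpolation between the law of the counts and the Poisson law. -/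
noncomputable def interpolationDeriv (P : Ω → ℝ) (κ : Γ → ι) (τ : ι → A) (I : Γ → Ω → ℝ) (p : Γ → ℝ)
    (s : ℝ) : A :=
  ∑ α, (τ (κ α) - 1) * (p α • ∑ ω, P ω • thinnedProd κ τ I (1 - s) Finset.univ ω -
    ∑ ω, (P ω * I α ω) • thinnedProd κ τ I (1 - s) (Finset.univ.erase α) ω) *
      NormedSpace.exp (s • ∑ α, p α • (τ (κ α) - 1))

/-- The product rule along the path that thins the counts to retention `1 - s` while adding Poisson
mass of mean `s p`. -/
theorem hasDerivAt_interpolation [CompleteSpace A] (P : Ω → ℝ) (κ : Γ → ι) (τ : ι → A) (I : Γ → Ω → ℝ) (p : Γ → ℝ)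
    (s : ℝ) :
    HasDerivAt (fun s : ℝ => (∑ ω, P ω • thinnedProd κ τ I (1 - s) Finset.univ ω) *
      NormedSpace.exp (s • ∑ α, p α • (τ (κ α) - 1))) (interpolationDeriv P κ τ I p s) s := by
  have h1 : ∀ α ω, HasDerivAt (fun s : ℝ => 1 + ((1 - s) * I α ω) • (τ (κ α) - 1))
      ((-I α ω) • (τ (κ α) - 1)) s := fun α ω => by
    have := (((hasDerivAt_id s).const_sub 1).mul_const (I α ω)).smul_const (τ (κ α) - 1)
    simpa using this.const_add 1
  have h2 : ∀ ω, HasDerivAt (fun s : ℝ => thinnedProd κ τ I (1 - s) Finset.univ ω)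
      (∑ α, thinnedProd κ τ I (1 - s) (Finset.univ.erase α) ω • ((-I α ω) • (τ (κ α) - 1))) s :=
    fun ω => HasDerivAt.fun_finsetProd fun α _ => h1 α ω
  have h3 := HasDerivAt.fun_sum (u := Finset.univ) fun ω _ => (h2 ω).const_smul (P ω)
  have h4 := h3.mul (hasDerivAt_exp_smul_const (∑ α, p α • (τ (κ α) - 1)) s)
  refine h4.congr_deriv ?_
  simp only [interpolationDeriv, Pi.smul_apply]
  generalize NormedSpace.exp (s • ∑ α, p α • (τ (κ α) - 1)) = E
  have e1 : ∑ ω, P ω • ∑ α, thinnedProd κ τ I (1 - s) (Finset.univ.erase α) ω •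
        ((-I α ω) • (τ (κ α) - 1)) = -∑ α, (τ (κ α) - 1) *
          ∑ ω, (P ω * I α ω) • thinnedProd κ τ I (1 - s) (Finset.univ.erase α) ω := by
    simp only [Finset.smul_sum, Finset.mul_sum, ← Finset.sum_neg_distrib]
    rw [Finset.sum_comm]
    refine Finset.sum_congr rfl fun α _ => Finset.sum_congr rfl fun ω _ => ?_
    simp only [smul_eq_mul, Algebra.smul_def (R := ℝ), map_mul, map_neg]
    ring
  have e2 : ∀ X : A, ∑ α, (τ (κ α) - 1) * (p α • X) = (∑ α, p α • (τ (κ α) - 1)) * X := fun X => by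
    rw [Finset.sum_mul]
    exact Finset.sum_congr rfl fun α _ => by rw [smul_mul_assoc, mul_smul_comm]
  rw [e1, ← Finset.sum_mul]
  simp only [mul_sub, Finset.sum_sub_distrib]
  rw [e2]
  ring

/-- The bound for the derivative of the interpolation in a dependency neighbourhood structure. -/
theorem norm_interpolationDeriv_le [NormOneClass A] {P : Ω → ℝ} (hP : ∀ ω, 0 ≤ P ω) (κ : Γ → ι) {τ : ι → A}
    (hτ : ∀ i, ‖τ i‖ ≤ 1) {I : Γ → Ω → ℝ} (hI0 : ∀ α ω, 0 ≤ I α ω) (hI1 : ∀ α ω, I α ω ≤ 1)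
    {p : Γ → ℝ} (hp : ∀ α, p α = ∑ ω, P ω * I α ω) {N : Γ → Finset Γ} (hN : ∀ α, α ∈ N α)
    (hind : ∀ α (c : ℝ), ∑ ω, (P ω * I α ω) • thinnedProd κ τ I c (N α)ᶜ ω =
      p α • ∑ ω, P ω • thinnedProd κ τ I c (N α)ᶜ ω)
    {s : ℝ} (hs0 : 0 ≤ s) (hs1 : s ≤ 1) {K : ℝ}
    (hK : ∀ i j, ‖(τ i - 1) * (τ j - 1) *
      NormedSpace.exp (s • ∑ α, p α • (τ (κ α) - 1))‖ ≤ K) :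
    ‖interpolationDeriv P κ τ I p s‖ ≤ (∑ α, ∑ β ∈ N α, p α * p β +
      ∑ α, ∑ β ∈ (N α).erase α, ∑ ω, P ω * (I α ω * I β ω)) * K := by
  rw [interpolationDeriv, ← Finset.sum_add_distrib, Finset.sum_mul]
  refine (norm_sum_le _ _).trans (Finset.sum_le_sum fun α _ => ?_)
  set E := NormedSpace.exp (s • ∑ α, p α • (τ (κ α) - 1))
  set U := thinnedProd κ τ I (1 - s)
  have hc0 : 0 ≤ 1 - s := by linarith
  have hc1 : 1 - s ≤ 1 := by linarith
  have hp0 : 0 ≤ p α := by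
    rw [hp]; exact Finset.sum_nonneg fun ω _ => mul_nonneg (hP ω) (hI0 _ _)
  have huniv : Finset.univ = N α ∪ (N α)ᶜ := (Finset.union_compl _).symm
  have herase : Finset.univ.erase α = (N α).erase α ∪ (N α)ᶜ := by
    ext β
    by_cases h : β = α <;> simp [h, hN, em]
  -- The product over the complement of `N α` is subtracted in both terms; by `hind` the two
  -- subtracted quantities agree. The first difference then yields the `p α * p β`, the second the
  -- joint probabilities.
  have e : (τ (κ α) - 1) * (p α • ∑ ω, P ω • U Finset.univ ω -
      ∑ ω, (P ω * I α ω) • U (Finset.univ.erase α) ω) * E =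
      p α • ∑ ω, P ω • ((τ (κ α) - 1) * (U (N α ∪ (N α)ᶜ) ω - U (N α)ᶜ ω) * E) -
      ∑ ω, (P ω * I α ω) • ((τ (κ α) - 1) *
        (U ((N α).erase α ∪ (N α)ᶜ) ω - U (N α)ᶜ ω) * E) := by
    have lin : ∀ (w : Ω → ℝ) (S T : Finset Γ), ∑ ω, w ω • ((τ (κ α) - 1) * (U S ω - U T ω) * E) =
        (τ (κ α) - 1) * (∑ ω, w ω • U S ω - ∑ ω, w ω • U T ω) * E := fun w S T => by
      rw [← Finset.sum_sub_distrib, Finset.mul_sum, Finset.sum_mul]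
      refine Finset.sum_congr rfl fun ω _ => ?_
      rw [← smul_sub, mul_smul_comm, smul_mul_assoc]
    rw [lin, lin fun ω => P ω * I α ω, ← smul_mul_assoc, ← mul_smul_comm, smul_sub, ← hind α,
      ← huniv, ← herase]
    ring
  rw [e]
  refine (norm_sub_le _ _).trans ?_
  rw [add_mul]
  refine add_le_add ?_ ?_
  · rw [norm_smul, Real.norm_of_nonneg hp0, ← Finset.mul_sum, mul_assoc]
    refine mul_le_mul_of_nonneg_left ?_ hp0
    calc _ ≤ ∑ ω, P ω * ∑ β ∈ N α, I β ω * K := by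
          refine (norm_sum_le _ _).trans (Finset.sum_le_sum fun ω _ => ?_)
          rw [norm_smul, Real.norm_of_nonneg (hP ω)]
          exact mul_le_mul_of_nonneg_left (norm_thinnedProd_union_sub_le κ hτ hI0 hI1 hc0 hc1
            disjoint_compl_right _ (hK _) ω) (hP ω)
      _ = _ := by
          simp only [Finset.mul_sum, Finset.sum_mul, hp]
          rw [Finset.sum_comm]
          exact Finset.sum_congr rfl fun β _ => Finset.sum_congr rfl fun ω _ => by ring
  · calc _ ≤ ∑ ω, P ω * I α ω * ∑ β ∈ (N α).erase α, I β ω * K := by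
          refine (norm_sum_le _ _).trans (Finset.sum_le_sum fun ω _ => ?_)
          have h0 : 0 ≤ P ω * I α ω := mul_nonneg (hP ω) (hI0 _ _)
          rw [norm_smul, Real.norm_of_nonneg h0]
          exact mul_le_mul_of_nonneg_left (norm_thinnedProd_union_sub_le κ hτ hI0 hI1 hc0 hc1
            (disjoint_compl_right.mono_left (Finset.erase_subset _ _)) _ (hK _) ω) h0
      _ = _ := by
          simp only [Finset.mul_sum, Finset.sum_mul]
          rw [Finset.sum_comm]
          exact Finset.sum_congr rfl fun β _ => Finset.sum_congr rfl fun ω _ => by ring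

/-- Multivariate Poisson approximation of a sum of locally dependent indicators, as an inequality
between the generating elements in a commutative Banach algebra. -/
theorem norm_expectation_thinnedProd_sub_exp_le [CompleteSpace A] [NormOneClass A] [Fintype ι]
    {P : Ω → ℝ} (hP : ∀ ω, 0 ≤ P ω)
    (hP1 : ∑ ω, P ω = 1) (κ : Γ → ι) {τ : ι → A}
    (hτ : ∀ i, ‖τ i‖ ≤ 1) {I : Γ → Ω → ℝ} (hI0 : ∀ α ω, 0 ≤ I α ω) (hI1 : ∀ α ω, I α ω ≤ 1)
    {p : Γ → ℝ} (hp : ∀ α, p α = ∑ ω, P ω * I α ω) {N : Γ → Finset Γ} (hN : ∀ α, α ∈ N α)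
    (hind : ∀ α (c : ℝ), ∑ ω, (P ω * I α ω) • thinnedProd κ τ I c (N α)ᶜ ω =
      p α • ∑ ω, P ω • thinnedProd κ τ I c (N α)ᶜ ω)
    {μ : ι → ℝ} (hμ : ∀ x : ι → A, ∑ α, p α • x (κ α) = ∑ i, μ i • x i)
    {M : ℝ} (hM : 1 ≤ M) (hμM : ∀ i, M ≤ μ i) {B : ℝ}
    (hB : ∑ α, ∑ β ∈ N α, p α * p β +
      ∑ α, ∑ β ∈ (N α).erase α, ∑ ω, P ω * (I α ω * I β ω) ≤ B) :
    ‖∑ ω, P ω • thinnedProd κ τ I 1 Finset.univ ω -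
      NormedSpace.exp (∑ i, μ i • (τ i - 1))‖ ≤ B * (4 + 2 * Real.log M) / M := by
  have hM0 : 0 < M := by linarith
  have hexp : ∀ s : ℝ, s • ∑ α, p α • (τ (κ α) - 1) = ∑ i, (s * μ i) • (τ i - 1) := fun s => by
    rw [hμ fun i => τ i - 1, Finset.smul_sum]
    simp only [smul_smul]
  have key := norm_sub_le_of_deriv_le (hasDerivAt_interpolation P κ τ I p) (B := B) hM
    (fun s hs0 hs1 => (norm_interpolationDeriv_le hP κ hτ hI0 hI1 hp hN hind hs0 hs1
      (fun i j => by
        rw [hexp]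
        exact norm_second_difference_mul_exp_le_four hτ
          (fun k => mul_nonneg hs0 (hM0.le.trans (hμM k))) i j)).trans
      (mul_le_mul_of_nonneg_right hB (by norm_num)))
    (fun s hs0 hs1 => (norm_interpolationDeriv_le hP κ hτ hI0 hI1 hp hN hind hs0.le hs1
      (fun i j => by
        rw [hexp]
        exact norm_second_difference_mul_exp_le hτ (mul_pos hs0 hM0)
          (fun k => mul_le_mul_of_nonneg_left (hμM k) hs0.le) i j)).trans
      (mul_le_mul_of_nonneg_right hB (by positivity)))
  rw [norm_sub_rev] at key
  have hz : ∑ ω, P ω • thinnedProd κ τ I 0 Finset.univ ω = 1 := by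
    simp [thinnedProd, ← Finset.sum_smul, hP1]
  simpa only [hexp, sub_zero, sub_self, zero_mul, one_mul, zero_smul, Finset.sum_const_zero,
    NormedSpace.exp_zero, mul_one, hz] using key

end Interpolation

/-! ### The commutative Banach algebra of shifts on `ℕ^ι`. -/

section ShiftAlgebra

open scoped BoundedContinuousFunction

universe u

/-- The space of bounded functions on `ℕ^ι`. -/
def BddFun (ι : Type u) : Type u := (ι → ℕ) →ᵇ ℝ

namespace BddFun

noncomputable instance (ι : Type u) : NormedAddCommGroup (BddFun ι) :=
  inferInstanceAs (NormedAddCommGroup ((ι → ℕ) →ᵇ ℝ))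

noncomputable instance (ι : Type u) : NormedSpace ℝ (BddFun ι) :=
  inferInstanceAs (NormedSpace ℝ ((ι → ℕ) →ᵇ ℝ))

instance (ι : Type u) : CompleteSpace (BddFun ι) :=
  inferInstanceAs (CompleteSpace ((ι → ℕ) →ᵇ ℝ))

instance (ι : Type u) : Nontrivial (BddFun ι) :=
  ⟨⟨BoundedContinuousFunction.const _ 0, BoundedContinuousFunction.const _ 1, fun h =>
    zero_ne_one (congrArg (fun f : (ι → ℕ) →ᵇ ℝ => f 0) h)⟩⟩

/-- Evaluation at a point. -/
noncomputable def eval {ι : Type u} (x : ι → ℕ) : BddFun ι →L[ℝ] ℝ := BoundedContinuousFunction.evalCLM ℝ x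

theorem ext_eval {ι : Type u} {f g : BddFun ι} (h : ∀ x, eval x f = eval x g) : f = g :=
  BoundedContinuousFunction.ext h

theorem abs_eval_le {ι : Type u} (f : BddFun ι) (x : ι → ℕ) : |eval x f| ≤ ‖f‖ :=
  BoundedContinuousFunction.norm_coe_le_norm (α := ι → ℕ) (β := ℝ) f x

/-- The indicator function of a set, as a bounded function. -/
noncomputable def ofSet {ι : Type u} [Fintype ι] (s : Set (ι → ℕ)) : BddFun ι :=
  BoundedContinuousFunction.ofNormedAddCommGroupDiscrete (s.indicator fun _ => 1) 1 fun x => by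
    by_cases h : x ∈ s <;> simp [h]

theorem eval_ofSet {ι : Type u} [Fintype ι] (s : Set (ι → ℕ)) (x : ι → ℕ) :
    eval x (ofSet s) = s.indicator (fun _ => 1) x := rfl

theorem norm_ofSet_le {ι : Type u} [Fintype ι] (s : Set (ι → ℕ)) : ‖ofSet s‖ ≤ 1 :=
  (BoundedContinuousFunction.norm_le zero_le_one).2 fun x => by
    change ‖s.indicator (fun _ => (1 : ℝ)) x‖ ≤ 1
    by_cases h : x ∈ s <;> simp [h]

end BddFun

open BddFun

variable (ι : Type u) [Fintype ι] [DecidableEq ι]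

/-- The shift operator `f ↦ f (· + e i)` on bounded functions on `ℕ^ι`. -/
noncomputable def shiftOp (i : ι) : BddFun ι →L[ℝ] BddFun ι :=
  LinearMap.mkContinuous
    { toFun := fun f => BoundedContinuousFunction.compContinuous f
        ⟨fun x => x + Pi.single i 1, continuous_of_discreteTopology⟩
      map_add' := fun _ _ => rfl
      map_smul' := fun _ _ => rfl } 1 fun f => by
    rw [one_mul]
    exact (BoundedContinuousFunction.norm_le (norm_nonneg _)).2 fun x =>
      BoundedContinuousFunction.norm_coe_le_norm (α := ι → ℕ) (β := ℝ) f _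

/-- The closed algebra generated by the shift operators. -/
noncomputable def shiftSubalgebra : Subalgebra ℝ (BddFun ι →L[ℝ] BddFun ι) :=
  (Algebra.adjoin ℝ (Set.range (shiftOp ι))).topologicalClosure

/-- Translations commute, and commutativity passes to the generated algebra and to its closure. -/
theorem shiftSubalgebra_mul_comm (x y : shiftSubalgebra ι) : x * y = y * x := by
  have h := Algebra.isMulCommutative_adjoin ℝ (s := Set.range (shiftOp ι)) (by
    rintro _ ⟨i, rfl⟩ _ ⟨j, rfl⟩
    ext f
    refine ext_eval fun x => ?_
    change eval (x + Pi.single i 1 + Pi.single j 1) f =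
      eval (x + Pi.single j 1 + Pi.single i 1) f
    rw [add_right_comm])
  exact (Subalgebra.commRingTopologicalClosure _ fun x y => h.is_comm.comm x y).mul_comm x y

noncomputable instance : NormedCommRing (shiftSubalgebra ι) :=
  { (inferInstance : NormedRing (shiftSubalgebra ι)) with
    mul_comm := shiftSubalgebra_mul_comm ι }

noncomputable instance : NormedAlgebra ℝ (shiftSubalgebra ι) :=
  SubalgebraClass.toNormedAlgebra (shiftSubalgebra ι)

/-- The commutative Banach algebra generated by the shift operators. -/
def ShiftAlgebra : Type u := shiftSubalgebra ι

namespace ShiftAlgebra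

noncomputable instance : NormedCommRing (ShiftAlgebra ι) :=
  inferInstanceAs (NormedCommRing (shiftSubalgebra ι))

noncomputable instance : NormedAlgebra ℝ (ShiftAlgebra ι) :=
  inferInstanceAs (NormedAlgebra ℝ (shiftSubalgebra ι))

instance : NormOneClass (ShiftAlgebra ι) := ⟨by
  change ‖(1 : BddFun ι →L[ℝ] BddFun ι)‖ = 1
  exact norm_one⟩

instance : CompleteSpace (ShiftAlgebra ι) :=
  (Subalgebra.isClosed_topologicalClosure _).completeSpace_coe

end ShiftAlgebra

/-- The shift operator as an element of the shift algebra. -/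
noncomputable def shift (i : ι) : ShiftAlgebra ι :=
  ⟨shiftOp ι i, Subalgebra.le_topologicalClosure _ (Algebra.subset_adjoin ⟨i, rfl⟩)⟩

theorem norm_shift_le (i : ι) : ‖shift ι i‖ ≤ 1 :=
  ContinuousLinearMap.opNorm_le_bound (shiftOp ι i) zero_le_one fun f => by
    rw [one_mul]
    exact (BoundedContinuousFunction.norm_le (norm_nonneg _)).2 fun x =>
      BoundedContinuousFunction.norm_coe_le_norm (α := ι → ℕ) (β := ℝ) f _

variable {ι}

/-- The functional `T ↦ (T f) x` on the shift algebra. -/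
noncomputable def shiftEval (f : BddFun ι) (x : ι → ℕ) : ShiftAlgebra ι →L[ℝ] ℝ :=
  (eval x).comp ((ContinuousLinearMap.apply ℝ _ f).comp
    (Submodule.subtypeL (Subalgebra.toSubmodule (shiftSubalgebra ι))))

theorem shiftEval_apply (f : BddFun ι) (x : ι → ℕ) (T : ShiftAlgebra ι) :
    shiftEval f x T = eval x (T.1 f) := rfl

theorem shiftEval_mul (f : BddFun ι) (x : ι → ℕ) (S T : ShiftAlgebra ι) :
    shiftEval f x (S * T) = shiftEval (T.1 f) x S := rfl

theorem shiftEval_one (f : BddFun ι) (x : ι → ℕ) : shiftEval f x 1 = eval x f := rfl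

theorem shiftEval_shift (f : BddFun ι) (x : ι → ℕ) (i : ι) :
    shiftEval f x (shift ι i) = eval (x + Pi.single i 1) f := rfl

/-- With `f` an indicator and `x = 0`, this turns a norm bound between generating elements into a
bound between probabilities. -/
theorem abs_shiftEval_le {f : BddFun ι} (hf : ‖f‖ ≤ 1) (x : ι → ℕ) (T : ShiftAlgebra ι) :
    |shiftEval f x T| ≤ ‖T‖ :=
  (abs_eval_le _ x).trans
    ((T.1.le_opNorm f).trans (mul_le_of_le_one_right (norm_nonneg _) hf))

theorem shiftEval_shift_pow (f : BddFun ι) (x : ι → ℕ) (i : ι) (k : ℕ) :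
    shiftEval f x (shift ι i ^ k) = eval (x + Pi.single i k) f := by
  induction k generalizing f x with
  | zero => simp [shiftEval_one]
  | succ k ih =>
    rw [pow_succ', shiftEval_mul, shiftEval_shift]
    have := ih f (x + Pi.single i 1)
    rw [shiftEval_apply] at this
    rw [this, add_assoc, ← Pi.single_add, add_comm 1 k]

theorem shiftEval_prod_ite {Γ : Type*} (κ : Γ → ι) (p : Γ → Prop) [DecidablePred p] (S : Finset Γ)
    (f : BddFun ι) (x : ι → ℕ) :
    shiftEval f x (∏ α ∈ S, if p α then shift ι (κ α) else 1) =
      eval (x + ∑ α ∈ S, if p α then Pi.single (κ α) 1 else 0) f := by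
  classical
  induction S using Finset.induction_on generalizing x with
  | empty => simp [shiftEval_one]
  | insert a S ha ih =>
    rw [Finset.prod_insert ha, Finset.sum_insert ha, shiftEval_mul]
    split_ifs
    · rw [shiftEval_shift, ← shiftEval_apply, ih, add_assoc]
    · rw [shiftEval_one, ← shiftEval_apply, ih, zero_add]

/-- On functions of product form, the product Poisson semigroup acts coordinatewise. -/
theorem shiftEval_prod_exp (μ : ι → ℝ) (g G : ι → ℕ → ℝ)
    (hG : ∀ i a, HasSum (fun k : ℕ => Real.exp (-μ i) * μ i ^ k / k.factorial * g i (a + k)) (G i a))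
    (f : BddFun ι) (hf : ∀ x, eval x f = ∏ i, g i (x i)) (s : Finset ι) (x : ι → ℕ) :
    shiftEval f x (∏ i ∈ s, NormedSpace.exp (μ i • (shift ι i - 1))) =
      ∏ i, if i ∈ s then G i (x i) else g i (x i) := by
  induction s using Finset.induction_on generalizing x with
  | empty => simp [shiftEval_one, hf]
  | insert j s hj ih =>
    rw [Finset.prod_insert hj, shiftEval_mul]
    set R := ∏ i ∈ s, NormedSpace.exp (μ i • (shift ι i - 1))
    -- Expanding the new factor in powers of `shift ι j` moves only the coordinate `j`, which `R`
    -- has not touched.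
    have h1 := (hasSum_exp_smul_sub_one (shift ι j) (μ j)).mapL (shiftEval (R.1 f) x)
    refine h1.unique ?_
    have h2 := (hG j (x j)).mul_right
      (∏ i ∈ Finset.univ.erase j, if i ∈ s then G i (x i) else g i (x i))
    refine hasSum_of_eq h2 (fun k => ?_) ?_
    · rw [map_smul, shiftEval_shift_pow, ← shiftEval_apply, ih, smul_eq_mul, mul_assoc]
      congr 1
      rw [← Finset.mul_prod_erase _ _ (Finset.mem_univ j)]
      congr 1
      · simp [hj]
      · refine Finset.prod_congr rfl fun i hi => ?_
        simp [Finset.ne_of_mem_erase hi]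
    · rw [← Finset.mul_prod_erase _ _ (Finset.mem_univ j)]
      congr 1
      · simp
      · refine Finset.prod_congr rfl fun i hi => ?_
        simp [Finset.ne_of_mem_erase hi]

/-- The indicator of a point is a product over coordinates. From the start `a`, coordinate `i`
reaches `w i` with the Poisson weight of `w i - a`, or `0` if `a > w i`; the evaluation takes `a =
0`. -/
theorem shiftEval_exp_singleton (μ : ι → NNReal) (w : ι → ℕ) :
    shiftEval (ofSet {w}) 0 (NormedSpace.exp (∑ i, (μ i : ℝ) • (shift ι i - 1))) =
      (Measure.pi fun i => poissonMeasure (μ i)).real {w} := by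
  rw [exp_sum_of_real, measureReal_def, Measure.pi_singleton, ENNReal.toReal_prod]
  rw [shiftEval_prod_exp (fun i => (μ i : ℝ)) (fun i a => if a = w i then 1 else 0)
    (fun i a => if a ≤ w i then Real.exp (-μ i) * μ i ^ (w i - a) / (w i - a).factorial else 0)]
  · refine Finset.prod_congr rfl fun i _ => ?_
    simp [← measureReal_def, poissonMeasure_real_singleton]
  · intro i a
    split_ifs with h
    · refine hasSum_of_eq (hasSum_ite_eq (w i - a)
        (Real.exp (-μ i) * μ i ^ (w i - a) / (w i - a).factorial)) (fun k => ?_) rfl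
      by_cases hk : k = w i - a
      · simp [hk, Nat.add_sub_cancel' h]
      · rw [if_neg hk, if_neg (by omega), mul_zero]
    · refine hasSum_of_eq hasSum_zero (fun k => ?_) rfl
      rw [if_neg (by omega), mul_zero]
  · intro x
    rw [eval_ofSet]
    by_cases h : x = w
    · simp [h]
    · obtain ⟨i, hi⟩ := Function.ne_iff.1 h
      rw [Set.indicator_of_notMem (by simpa using h)]
      exact (Finset.prod_eq_zero (Finset.mem_univ i) (by simp [hi])).symm

theorem shiftEval_exp_finset (μ : ι → NNReal) (s : Finset (ι → ℕ)) :
    shiftEval (ofSet s) 0 (NormedSpace.exp (∑ i, (μ i : ℝ) • (shift ι i - 1))) =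
      (Measure.pi fun i => poissonMeasure (μ i)).real s := by
  have h : ofSet (s : Set (ι → ℕ)) = ∑ w ∈ s, ofSet {w} := by
    refine ext_eval fun x => ?_
    simp only [map_sum, eval_ofSet, Set.indicator_apply, Set.mem_singleton_iff, Finset.mem_coe,
      Finset.sum_ite_eq]
  rw [h, shiftEval_apply, map_sum, map_sum]
  simp only [← shiftEval_apply, shiftEval_exp_singleton]
  rw [sum_measureReal_singleton]

end ShiftAlgebra

/-! ### From the Banach algebra inequality to total variation. -/

section TotalVariation

/-- In a countable space every set is an increasing union of finite sets, and finite measures are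
continuous along it. -/
theorem tvDist_le_of_forall_finset {X : Type*} [MeasurableSpace X] [Countable X]
    [MeasurableSingletonClass X] (μ ν : Measure X) [IsFiniteMeasure μ] [IsFiniteMeasure ν]
    {d : ℝ} (h : ∀ s : Finset X, |μ.real s - ν.real s| ≤ d) : tvDist μ ν ≤ d := by
  have : Nonempty {A : Set X // MeasurableSet A} := ⟨⟨∅, MeasurableSet.empty⟩⟩
  refine ciSup_le fun A => ?_
  obtain ⟨f, hf⟩ := exists_injective_nat X
  let s : ℕ → Set X := fun n => A.1 ∩ f ⁻¹' Set.Iic n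
  have hfin : ∀ n, (s n).Finite := fun n =>
    ((Set.finite_Iic n).preimage hf.injOn).inter_of_right _
  have hmono : Monotone s := fun m n hmn =>
    Set.inter_subset_inter_right _ (Set.preimage_mono (Set.Iic_subset_Iic.2 hmn))
  have hU : ⋃ n, s n = A.1 := by
    ext x
    simp only [s, Set.mem_iUnion, Set.mem_inter_iff, Set.mem_preimage, Set.mem_Iic]
    exact ⟨fun ⟨_, h, _⟩ => h, fun h => ⟨f x, h, le_rfl⟩⟩
  have ht : ∀ (ρ : Measure X) [IsFiniteMeasure ρ],
      Filter.Tendsto (fun n => ρ.real (s n)) Filter.atTop (nhds (ρ.real A.1)) := fun ρ _ => by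
    have := tendsto_measure_iUnion_atTop (μ := ρ) hmono
    rw [hU] at this
    exact (ENNReal.tendsto_toReal (measure_ne_top ρ _)).comp this
  refine le_of_tendsto ((ht μ).sub (ht ν)).abs (Filter.Eventually.of_forall fun n => ?_)
  have := h (hfin n).toFinset
  rwa [Set.Finite.coe_toFinset] at this

theorem tvDist_le_one {X : Type*} [MeasurableSpace X] (μ ν : Measure X) [IsProbabilityMeasure μ]
    [IsProbabilityMeasure ν] : tvDist μ ν ≤ 1 := by
  have : Nonempty {A : Set X // MeasurableSet A} := ⟨⟨∅, MeasurableSet.empty⟩⟩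
  refine ciSup_le fun A => ?_
  rw [abs_le]
  constructor <;> linarith [measureReal_nonneg (μ := μ) (s := A.1), measureReal_le_one (μ := μ) (s := A.1),
    measureReal_nonneg (μ := ν) (s := A.1), measureReal_le_one (μ := ν) (s := A.1)]

theorem map_real_finset_eq_sum {Ω X : Type*} [Fintype Ω] [MeasurableSpace Ω]
    [DiscreteMeasurableSpace Ω] [MeasurableSpace X] [MeasurableSingletonClass X]
    (P : Measure Ω) [IsFiniteMeasure P] (W : Ω → X) (s : Finset X) :
    (P.map W).real s = ∑ ω, P.real {ω} * (s : Set X).indicator (fun _ => 1) (W ω) := by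
  classical
  rw [measureReal_def, Measure.map_apply (measurable_of_finite W) s.measurableSet, ← measureReal_def]
  have : W ⁻¹' s = ((Finset.univ.filter fun ω => W ω ∈ s : Finset Ω) : Set Ω) := by
    ext; simp
  rw [this, ← sum_measureReal_singleton, Finset.sum_filter]
  refine Finset.sum_congr rfl fun ω _ => ?_
  simp [Set.indicator_apply]

universe u

/-- Multivariate Poisson approximation in total variation for the counts of locally dependent
events. -/
theorem tvDist_counts_pi_poissonMeasure_le {Ω Γ : Type*} {ι : Type u} [Fintype Ω]
    [MeasurableSpace Ω] [DiscreteMeasurableSpace Ω] [Fintype Γ] [DecidableEq Γ] [Fintype ι]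
    (P : Measure Ω) [IsProbabilityMeasure P] (κ : Γ → ι) (I : Γ → Ω → ℝ)
    (hI : ∀ α ω, I α ω = 0 ∨ I α ω = 1) (W : Ω → ι → ℕ)
    (hW : ∀ ω (x : ι → ℝ), ∑ α, I α ω * x (κ α) = ∑ i, W ω i * x i)
    {p : Γ → ℝ} (hp : ∀ α, p α = ∑ ω, P.real {ω} * I α ω)
    {N : Γ → Finset Γ} (hN : ∀ α, α ∈ N α)
    (hind : ∀ (V : Type u) [AddCommGroup V] [Module ℝ V] (α : Γ) (g : Ω → V),
      (∀ ω ω', (∀ β, β ∉ N α → I β ω = I β ω') → g ω = g ω') →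
        ∑ ω, (P.real {ω} * I α ω) • g ω = p α • ∑ ω, P.real {ω} • g ω)
    (μ : ι → NNReal) (hμ : ∀ i, (μ i : ℝ) = ∑ ω, P.real {ω} * W ω i)
    {M : ℝ} (hM : 1 ≤ M) (hμM : ∀ i, M ≤ μ i) {B : ℝ}
    (hB : ∑ α, ∑ β ∈ N α, p α * p β +
      ∑ α, ∑ β ∈ (N α).erase α, ∑ ω, P.real {ω} * (I α ω * I β ω) ≤ B) :
    tvDist (P.map W) (Measure.pi fun i => poissonMeasure (μ i)) ≤
      B * (4 + 2 * Real.log M) / M := by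
  classical
  have hP1 : ∑ ω, P.real {ω} = 1 := by
    rw [sum_measureReal_singleton]; simp
  have : IsProbabilityMeasure (P.map W) :=
    Measure.isProbabilityMeasure_map (measurable_of_finite W).aemeasurable
  refine tvDist_le_of_forall_finset _ _ fun s => ?_
  have hcount : ∀ ω i, ∑ α, I α ω * (if κ α = i then 1 else 0) = (W ω i : ℝ) := fun ω i => by
    rw [hW ω fun j => if j = i then 1 else 0]
    simp
  have hpμ : ∀ i, ∑ α, (if κ α = i then p α else 0) = (μ i : ℝ) := fun i => by
    simp only [hμ, ← hcount, hp, Finset.mul_sum]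
    rw [Finset.sum_comm]
    refine Finset.sum_congr rfl fun α _ => ?_
    split_ifs <;> simp
  have key := norm_expectation_thinnedProd_sub_exp_le (A := ShiftAlgebra ι)
    (P := fun ω => P.real {ω}) (fun _ => measureReal_nonneg) hP1 κ (norm_shift_le ι)
    (fun α ω => by rcases hI α ω with h | h <;> simp [h])
    (fun α ω => by rcases hI α ω with h | h <;> simp [h]) hp hN
    (fun α c => hind _ α _ fun ω ω' h => Finset.prod_congr rfl fun β hβ => by
      rw [h β (by simpa using hβ)])
    (μ := fun i => (μ i : ℝ)) (fun x => by
      simp only [← hpμ, Finset.sum_smul, ite_smul, zero_smul]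
      rw [Finset.sum_comm]
      simp) hM hμM hB
  -- Applied to the indicator of `s` at the origin, the two generating elements become the two
  -- probabilities of `s`.
  refine le_trans ?_ ((abs_shiftEval_le (BddFun.norm_ofSet_le (s : Set (ι → ℕ))) 0 _).trans key)
  rw [map_sub, shiftEval_exp_finset, map_sum, map_real_finset_eq_sum]
  refine le_of_eq (congrArg (fun x => |x - _|) (Finset.sum_congr rfl fun ω _ => ?_))
  rw [map_smul, smul_eq_mul]
  congr 1
  have hT : thinnedProd κ (shift ι) I 1 Finset.univ ω =
      ∏ α, if I α ω = 1 then shift ι (κ α) else 1 := by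
    refine Finset.prod_congr rfl fun α _ => ?_
    rcases hI α ω with h | h <;> simp [h]
  rw [hT, shiftEval_prod_ite, BddFun.eval_ofSet, zero_add]
  congr 1
  funext i
  rw [Finset.sum_apply, ← Nat.cast_inj (R := ℝ), ← hcount, Nat.cast_sum]
  refine Finset.sum_congr rfl fun α _ => ?_
  rcases hI α ω with h | h <;> simp [h, Pi.single_apply, eq_comm]

end TotalVariation

/-! ### Weighted walk sums for the kernel `1 / max`. -/

section WalkSums

/-- The last vertex is summed out repeatedly; `hG` says that each summation replaces `G (i + 1)` by
at most `G i`. -/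
theorem sum_path_le {V : Type*} [Fintype V] (k : ℕ) {J : ℕ → V → V → ℝ} {G : ℕ → V → ℝ}
    (hJ : ∀ i x y, 0 ≤ J i x y) (hG : ∀ i < k, ∀ x, ∑ y, J i x y * G (i + 1) y ≤ G i x)
    {f : V → ℝ} (hf : ∀ x, 0 ≤ f x) :
    ∑ v : Fin (k + 1) → V, f (v 0) * (∏ i : Fin k, J i (v i.castSucc) (v i.succ)) *
      G k (v (Fin.last k)) ≤ ∑ x, f x * G 0 x := by
  induction k with
  | zero =>
    refine le_of_eq ((Equiv.funUnique (Fin 1) V).sum_comp (fun x => f x * G 0 x) ▸ ?_)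
    exact Finset.sum_congr rfl fun v _ => by simp
  | succ k ih =>
    rw [← (Fin.snocEquiv fun _ => V).sum_comp, Fintype.sum_prod_type_right]
    refine le_trans (Finset.sum_le_sum fun w _ => ?_) (ih fun i hi => hG i (by omega))
    have e : ∀ y : V, (Fin.snocEquiv fun _ : Fin (k + 2) => V) (y, w) = Fin.snoc w y := fun _ => rfl
    have e0 : ∀ y : V, Fin.snoc (α := fun _ => V) w y 0 = w 0 := fun y => by
      rw [← Fin.castSucc_zero, Fin.snoc_castSucc]
    simp only [e, e0, Fin.snoc_last, Fin.prod_univ_castSucc, Fin.snoc_castSucc, Fin.succ_castSucc,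
      Fin.succ_last, Fin.val_castSucc, Fin.val_last]
    have h0 : 0 ≤ f (w 0) * ∏ i : Fin k, J i (w i.castSucc) (w i.succ) :=
      mul_nonneg (hf _) (Finset.prod_nonneg fun i _ => hJ _ _ _)
    calc _ = (f (w 0) * ∏ i : Fin k, J i (w i.castSucc) (w i.succ)) *
          ∑ y, J k (w (Fin.last k)) y * G (k + 1) y := by
          rw [Finset.mul_sum]
          exact Finset.sum_congr rfl fun y _ => by ring
      _ ≤ _ := mul_le_mul_of_nonneg_left (hG k (by omega) _) h0

/-- The terms with `y ≤ x` and those with `y > x` contribute at most `2 / √(x + 1)` each. The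
induction runs on the partial sums, whose two bounds agree at `n = x + 1`. -/
theorem sum_range_inv_max_mul_inv_sqrt_le (x n : ℕ) :
    ∑ y ∈ Finset.range n, 1 / ((max x y : ℕ) + 1 : ℝ) * (1 / √(y + 1)) ≤ 4 / √(x + 1) := by
  have key : ∑ y ∈ Finset.range n, 1 / ((max x y : ℕ) + 1 : ℝ) * (1 / √(y + 1)) ≤
      if n ≤ x + 1 then 2 * √n / (x + 1) else 4 / √(x + 1) - 2 / √n := by
    induction n with
    | zero => simp
    | succ n ih =>
      rw [Finset.sum_range_succ]
      have ha : (0 : ℝ) < √(n + 1) := Real.sqrt_pos.2 (by positivity)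
      have hb : √(n : ℝ) ≤ √(n + 1) := Real.sqrt_le_sqrt (by linarith)
      have ha2 : √((n : ℝ) + 1) ^ 2 = n + 1 := Real.sq_sqrt (by positivity)
      have hb2 : √(n : ℝ) ^ 2 = n := Real.sq_sqrt (by positivity)
      have hstep : 1 / √((n : ℝ) + 1) ≤ 2 * (√(n + 1) - √n) := by
        rw [div_le_iff₀ ha]
        nlinarith [sq_nonneg (√((n : ℝ) + 1) - √n)]
      by_cases h : n + 1 ≤ x + 1
      · rw [if_pos (by omega)] at ih
        rw [if_pos h, max_eq_left (by omega)]
        have hx : (0 : ℝ) < x + 1 := by positivity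
        calc _ ≤ 2 * √n / (x + 1) + 1 / ((x : ℝ) + 1) * (2 * (√(n + 1) - √n)) := by gcongr
          _ = _ := by push_cast; field_simp; ring
      · rw [if_neg h, max_eq_right (by omega)]
        have hn0 : (0 : ℝ) < n := by exact_mod_cast (by omega : 0 < n)
        have hsn : 0 < √(n : ℝ) := Real.sqrt_pos.2 hn0
        have hih : ∑ y ∈ Finset.range n, 1 / ((max x y : ℕ) + 1 : ℝ) * (1 / √(y + 1)) ≤
            4 / √(x + 1) - 2 / √n := by
          by_cases h' : n ≤ x + 1
          · rw [if_pos h'] at ih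
            obtain rfl : n = x + 1 := by omega
            refine ih.trans (le_of_eq ?_)
            push_cast at hsn hb2 ⊢
            field_simp
            linarith
          · rwa [if_neg h'] at ih
        have : 1 / ((n : ℝ) + 1) * (1 / √(n + 1)) ≤ 2 / √n - 2 / √(n + 1) := by
          calc 1 / ((n : ℝ) + 1) * (1 / √(n + 1)) ≤ 1 / ((n : ℝ) + 1) * (2 * (√(n + 1) - √n)) := by
                gcongr
            _ = 2 * (√(n + 1) - √n) / (√(n + 1) * √(n + 1)) := by
                rw [Real.mul_self_sqrt (by positivity)]; field_simp
            _ ≤ 2 * (√(n + 1) - √n) / (√n * √(n + 1)) := by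
                have : 0 ≤ 2 * (√((n : ℝ) + 1) - √n) := by linarith
                gcongr
            _ = 2 / √n - 2 / √(n + 1) := by field_simp
        rw [Nat.cast_succ]
        linarith
  refine key.trans ?_
  have hx : (0 : ℝ) < √((x : ℝ) + 1) := Real.sqrt_pos.2 (by positivity)
  split_ifs with h
  · have h1 : √(n : ℝ) ≤ √(x + 1) := Real.sqrt_le_sqrt (by exact_mod_cast h)
    have h2 : √((x : ℝ) + 1) ^ 2 = x + 1 := Real.sq_sqrt (by positivity)
    rw [div_le_div_iff₀ (by positivity) hx]
    nlinarith
  · have : 0 ≤ 2 / √(n : ℝ) := by positivity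
    linarith

/-- An upper bound for the probability of an edge with given endpoints. -/
noncomputable def edgeKernel (n : ℕ) (x y : Fin n) : ℝ := 2 / ((max x.val y.val : ℕ) + 1)

/-- The test function `1 / √x` for the edge kernel. -/
noncomputable def invSqrt (n : ℕ) (x : Fin n) : ℝ := 1 / √(x.val + 1)

theorem edgeKernel_nonneg {n : ℕ} (x y : Fin n) : 0 ≤ edgeKernel n x y := by
  unfold edgeKernel; positivity

theorem invSqrt_pos {n : ℕ} (x : Fin n) : 0 < invSqrt n x := by
  unfold invSqrt; positivity

theorem invSqrt_le_one {n : ℕ} (x : Fin n) : invSqrt n x ≤ 1 := by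
  unfold invSqrt
  rw [div_le_one (by positivity)]
  exact Real.one_le_sqrt.2 (by linarith [(Nat.cast_nonneg x.val : (0 : ℝ) ≤ _)])

theorem invSqrt_mul_self {n : ℕ} (x : Fin n) : invSqrt n x * invSqrt n x = 1 / (x.val + 1) := by
  unfold invSqrt
  rw [div_mul_div_comm, Real.mul_self_sqrt (by positivity), one_mul]

/-- The maximum dominates the geometric mean. -/
theorem edgeKernel_le {n : ℕ} (x y : Fin n) :
    edgeKernel n x y ≤ 2 * (invSqrt n x * invSqrt n y) := by
  unfold edgeKernel invSqrt
  rw [div_mul_div_comm, one_mul, mul_one_div]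
  refine div_le_div_of_nonneg_left (by norm_num) (by positivity) ?_
  have hx : ((x.val : ℕ) : ℝ) ≤ (max x.val y.val : ℕ) := by exact_mod_cast le_max_left _ _
  have hy : ((y.val : ℕ) : ℝ) ≤ (max x.val y.val : ℕ) := by exact_mod_cast le_max_right _ _
  calc √((x.val : ℝ) + 1) * √(y.val + 1) ≤
        √((max x.val y.val : ℕ) + 1) * √((max x.val y.val : ℕ) + 1) := by gcongr
    _ = _ := Real.mul_self_sqrt (by positivity)

theorem sum_edgeKernel_mul_invSqrt_le {n : ℕ} (x : Fin n) :
    ∑ y, edgeKernel n x y * invSqrt n y ≤ 8 * invSqrt n x := by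
  have h := sum_range_inv_max_mul_inv_sqrt_le x.val n
  rw [← Fin.sum_univ_eq_sum_range
    (fun y : ℕ => 1 / ((max x.val y : ℕ) + 1 : ℝ) * (1 / √(y + 1)))] at h
  calc _ = 2 * ∑ y : Fin n, 1 / ((max x.val y.val : ℕ) + 1 : ℝ) * (1 / √(y.val + 1)) := by
        rw [Finset.mul_sum]
        refine Finset.sum_congr rfl fun y _ => ?_
        unfold edgeKernel invSqrt; ring
    _ ≤ 2 * (4 / √(x.val + 1)) := by gcongr
    _ = _ := by unfold invSqrt; ring

/-- The weighted number of closed walks through a vertex. -/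
theorem sum_closed_walk_le {n : ℕ} (k : ℕ) (x : Fin n) :
    ∑ v : Fin (k + 1) → Fin n, (if v 0 = x then 1 else 0) *
      (∏ i : Fin k, edgeKernel n (v i.castSucc) (v i.succ)) * edgeKernel n (v (Fin.last k)) x ≤
      2 * 8 ^ k * (1 / (x.val + 1)) := by
  -- The closing step is relaxed to `2 * invSqrt y * invSqrt x`; each of the `k` summations
  -- reproduces `invSqrt` with a factor `8`.
  have h := sum_path_le k (J := fun _ => edgeKernel n)
    (G := fun i y => 8 ^ (k - i) * (2 * (invSqrt n y * invSqrt n x)))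
    (fun _ => edgeKernel_nonneg) (fun i hi z => by
      calc _ = 8 ^ (k - (i + 1)) * (2 * invSqrt n x) * ∑ y, edgeKernel n z y * invSqrt n y := by
            rw [Finset.mul_sum]
            exact Finset.sum_congr rfl fun y _ => by ring
        _ ≤ 8 ^ (k - (i + 1)) * (2 * invSqrt n x) * (8 * invSqrt n z) := by
            have := invSqrt_pos x
            gcongr
            exact sum_edgeKernel_mul_invSqrt_le z
        _ = 8 ^ (k - (i + 1) + 1) * (2 * (invSqrt n z * invSqrt n x)) := by ring
        _ = _ := by rw [show k - (i + 1) + 1 = k - i by omega])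
    (f := fun y => if y = x then 1 else 0) (fun y => by split_ifs <;> norm_num)
  refine (Finset.sum_le_sum fun v _ => ?_).trans (h.trans (le_of_eq ?_))
  · rw [Nat.sub_self, pow_zero, one_mul]
    refine mul_le_mul_of_nonneg_left (edgeKernel_le _ _) (mul_nonneg (by split_ifs <;> norm_num)
      (Finset.prod_nonneg fun i _ => edgeKernel_nonneg _ _))
  · simp only [ite_mul, one_mul, zero_mul, Finset.sum_ite_eq', Finset.mem_univ, if_true]
    rw [invSqrt_mul_self, Nat.sub_zero]; ring

/-- The weighted number of walks from `S` to `S` whose steps within `S` are free of charge,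
except for the first step. -/
theorem sum_walk_to_set_le {n : ℕ} (k : ℕ) (S : Finset (Fin n)) {L : ℝ} (hL : S.card ≤ L) :
    ∑ v : Fin (k + 2) → Fin n, (if v 0 ∈ S then 1 else 0) *
      (edgeKernel n (v 0) (v 1) * ∏ i : Fin k, (edgeKernel n (v i.succ.castSucc) (v i.succ.succ) +
        if v i.succ.castSucc ∈ S ∧ v i.succ.succ ∈ S then 1 else 0)) *
      (if v (Fin.last (k + 1)) ∈ S then 1 else 0) ≤
      10 * (10 + L + L ^ 2) ^ k * L * ∑ z ∈ S, 1 / (z.val + 1 : ℝ) := by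
  have hL0 : 0 ≤ L := le_trans (Nat.cast_nonneg _) hL
  set H := ∑ z ∈ S, invSqrt n z with hH
  have hH0 : 0 ≤ H := Finset.sum_nonneg fun z _ => (invSqrt_pos z).le
  have hHL : H ≤ L := by
    refine le_trans (Finset.sum_le_sum fun z _ => invSqrt_le_one z) ?_
    simpa using hL
  -- One factor `H` arises at each end of the walk; Cauchy–Schwarz turns `H ^ 2` into the sum of
  -- inverses.
  have hH2 : H ^ 2 ≤ L * ∑ z ∈ S, 1 / (z.val + 1 : ℝ) := by
    have hs : ∑ z ∈ S, 1 / (z.val + 1 : ℝ) = ∑ z ∈ S, invSqrt n z ^ 2 :=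
      Finset.sum_congr rfl fun z _ => by rw [sq, invSqrt_mul_self]
    rw [hs]
    exact sq_sum_le_card_mul_sum_sq.trans
      (mul_le_mul_of_nonneg_right hL (Finset.sum_nonneg fun z _ => sq_nonneg _))
  set c := 10 + L + L ^ 2 with hc
  have hc0 : 0 ≤ c := by positivity
  let χ : Fin n → ℝ := fun x => if x ∈ S then 1 else 0
  have hχ0 : ∀ x, 0 ≤ χ x := fun x => by simp only [χ]; split_ifs <;> norm_num
  have hh0 : ∀ x, 0 ≤ H * invSqrt n x := fun x => mul_nonneg hH0 (invSqrt_pos x).le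
  -- A charged step removes `χ` from the test function `χ + H * invSqrt`. Since the first step is
  -- charged, the final sum over `S` is of order `H ^ 2` and not merely `L`.
  have hKg : ∀ x, ∑ y, edgeKernel n x y * (χ y + H * invSqrt n y) ≤ 10 * (H * invSqrt n x) := by
    intro x
    have h1 : ∑ y, edgeKernel n x y * χ y ≤ 2 * (H * invSqrt n x) := by
      simp only [χ, mul_ite, mul_one, mul_zero, ← Finset.sum_filter, Finset.filter_univ_mem]
      refine (Finset.sum_le_sum fun z _ => edgeKernel_le x z).trans (le_of_eq ?_)
      rw [hH, Finset.sum_mul, Finset.mul_sum]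
      exact Finset.sum_congr rfl fun z _ => by ring
    have h2 : ∑ y, edgeKernel n x y * (H * invSqrt n y) ≤ 8 * (H * invSqrt n x) := by
      calc _ = H * ∑ y, edgeKernel n x y * invSqrt n y := by
            rw [Finset.mul_sum]
            exact Finset.sum_congr rfl fun y _ => by ring
        _ ≤ H * (8 * invSqrt n x) :=
            mul_le_mul_of_nonneg_left (sum_edgeKernel_mul_invSqrt_le x) hH0
        _ = _ := by ring
    simp only [mul_add, Finset.sum_add_distrib]
    linarith
  have hAg : ∀ x, ∑ y, (if x ∈ S ∧ y ∈ S then 1 else 0) * (χ y + H * invSqrt n y) ≤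
      (L + L ^ 2) * χ x := by
    intro x
    by_cases hx : x ∈ S
    · simp only [hx, true_and, χ, ite_mul, one_mul, zero_mul, ← Finset.sum_filter,
        Finset.filter_univ_mem, if_true, mul_one, Finset.sum_add_distrib, ← Finset.mul_sum, ← hH]
      refine add_le_add ?_ (by nlinarith)
      simpa [Finset.filter_mem_eq_inter] using hL
    · simp [hx, χ]
  have hJg : ∀ x, ∑ y, (edgeKernel n x y + if x ∈ S ∧ y ∈ S then 1 else 0) *
      (χ y + H * invSqrt n y) ≤ c * (χ x + H * invSqrt n x) := by
    intro x
    simp only [add_mul _ _ (χ _ + _), Finset.sum_add_distrib]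
    refine (add_le_add (hKg x) (hAg x)).trans ?_
    have := hχ0 x
    have := hh0 x
    have : 0 ≤ (L + L ^ 2) * (H * invSqrt n x) := by positivity
    rw [hc]
    linarith
  have h := sum_path_le (k + 1)
    (J := fun i x y => if i = 0 then edgeKernel n x y else
      edgeKernel n x y + if x ∈ S ∧ y ∈ S then 1 else 0)
    (G := fun i x => if i = 0 then c ^ k * (10 * (H * invSqrt n x)) else
      c ^ (k + 1 - i) * (χ x + H * invSqrt n x))
    (fun i x y => by
      have := edgeKernel_nonneg x y
      split_ifs <;> linarith) (fun i hi x => by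
      have hpull : ∀ (F : Fin n → ℝ) (j : ℕ), ∑ y, F y * (c ^ j * (χ y + H * invSqrt n y)) =
          c ^ j * ∑ y, F y * (χ y + H * invSqrt n y) := fun F j => by
        rw [Finset.mul_sum]
        exact Finset.sum_congr rfl fun y _ => by ring
      simp only [Nat.succ_ne_zero, if_false]
      rw [hpull]
      split_ifs with h0
      · subst h0
        simp only [zero_add, Nat.add_sub_cancel]
        exact mul_le_mul_of_nonneg_left (hKg x) (pow_nonneg hc0 _)
      · refine (mul_le_mul_of_nonneg_left (hJg x) (pow_nonneg hc0 _)).trans (le_of_eq ?_)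
        rw [← mul_assoc, ← pow_succ, show k + 1 - (i + 1) + 1 = k + 1 - i by omega])
    (f := χ) hχ0
  refine (Finset.sum_le_sum fun v _ => ?_).trans (h.trans ?_)
  · rw [Fin.prod_univ_succ]
    simp only [Nat.succ_ne_zero, if_false, Nat.sub_self, pow_zero, one_mul, Fin.val_zero, if_true,
      Fin.val_succ, Fin.castSucc_zero, Fin.succ_zero_eq_one]
    refine mul_le_mul_of_nonneg_left (le_add_of_nonneg_right (hh0 _)) (mul_nonneg (hχ0 _)
      (mul_nonneg (edgeKernel_nonneg _ _) (Finset.prod_nonneg fun i _ => ?_)))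
    have := edgeKernel_nonneg (v i.succ.castSucc) (v i.succ.succ)
    split_ifs <;> linarith
  · simp only [χ, if_true, ite_mul, one_mul, zero_mul, ← Finset.sum_filter, Finset.filter_univ_mem,
      ← Finset.mul_sum, ← hH]
    have := mul_le_mul_of_nonneg_left hH2 (by positivity : 0 ≤ 10 * c ^ k)
    linarith

theorem sum_inv_sq_le (n : ℕ) : ∑ x : Fin n, 1 / (x.val + 1 : ℝ) * (1 / (x.val + 1)) ≤ 2 := by
  rw [Fin.sum_univ_eq_sum_range (fun x : ℕ => 1 / (x + 1 : ℝ) * (1 / (x + 1)))]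
  have : ∑ x ∈ Finset.range n, 1 / (x + 1 : ℝ) * (1 / (x + 1)) ≤ 2 - 1 / n := by
    induction n with
    | zero => norm_num
    | succ n ih =>
      rw [Finset.sum_range_succ]
      rcases Nat.eq_zero_or_pos n with rfl | hn
      · norm_num
      · have hn' : (0 : ℝ) < n := by exact_mod_cast hn
        have : 1 / (n + 1 : ℝ) * (1 / (n + 1)) ≤ 1 / n - 1 / (n + 1) := by
          rw [div_sub_div _ _ hn'.ne' (by positivity), div_mul_div_comm,
            div_le_div_iff₀ (by positivity) (by positivity)]
          nlinarith
        rw [Nat.cast_succ]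
        linarith
  have h : (0 : ℝ) ≤ 1 / n := by positivity
  linarith

end WalkSums

namespace UniformAttachment

/-! ### Independence of the attachment choices. -/

section Law

variable {m n : ℕ}

instance (h : HalfEdge m n) : Nonempty (Fin h.1.1.val) := ⟨⟨0, h.1.2⟩⟩

theorem uniformOn_real_singleton {k : ℕ} (a : Fin k) :
    (uniformOn (Set.univ : Set (Fin k))).real {a} = 1 / k := by
  rw [measureReal_def, uniformOn_univ]
  simp

instance {k : ℕ} [Nonempty (Fin k)] : IsProbabilityMeasure (uniformOn (Set.univ : Set (Fin k))) :=
  isProbabilityMeasure_uniformOn Set.finite_univ Set.univ_nonempty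

instance : IsProbabilityMeasure (law m n) := by
  unfold law; infer_instance

/-- The probability of a single outcome. -/
theorem law_real_singleton (ω : Outcome m n) :
    (law m n).real {ω} = ∏ h : HalfEdge m n, 1 / (h.1.1.val : ℝ) := by
  rw [law, measureReal_def, Measure.pi_singleton, ENNReal.toReal_prod]
  exact Finset.prod_congr rfl fun h _ => uniformOn_real_singleton _

theorem sum_law_real_singleton : ∑ ω, (law m n).real {ω} = 1 := by
  rw [sum_measureReal_singleton]; simp

/-- The marginal probability of an edge. -/
noncomputable def edgeWeight (x : Edge m n) : ℝ := 1 / (x.1.1.1.val : ℝ)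

theorem edgeWeight_nonneg (x : Edge m n) : 0 ≤ edgeWeight x := by
  unfold edgeWeight; positivity

/-- The indicator of the event that all the edges of `T` are present. -/
noncomputable def present (T : Finset (Edge m n)) (ω : Outcome m n) : ℝ :=
  open Classical in if ∀ x ∈ T, ω x.1 = x.2 then 1 else 0

theorem present_eq_zero_or_one (T : Finset (Edge m n)) (ω : Outcome m n) :
    present T ω = 0 ∨ present T ω = 1 := by
  unfold present; split_ifs <;> simp

theorem present_nonneg (T : Finset (Edge m n)) (ω : Outcome m n) : 0 ≤ present T ω := by
  rcases present_eq_zero_or_one T ω with h | h <;> simp [h]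

theorem present_union [DecidableEq (Edge m n)] (S T : Finset (Edge m n)) (ω : Outcome m n) :
    present (S ∪ T) ω = present S ω * present T ω := by
  classical
  simp only [present, Finset.mem_union, or_imp, forall_and]
  split_ifs <;> simp_all

theorem present_congr {T : Finset (Edge m n)} {ω ω' : Outcome m n}
    (h : ∀ x ∈ T, ω x.1 = ω' x.1) : present T ω = present T ω' := by
  classical
  unfold present
  exact if_congr (forall₂_congr fun x hx => by rw [h x hx]) rfl rfl

/-- A half-edge makes a single choice, so two different edges on it cannot coexist. -/
theorem present_eq_zero_of_not_injOn {T : Finset (Edge m n)}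
    (hT : ¬Set.InjOn Sigma.fst (T : Set (Edge m n))) (ω : Outcome m n) : present T ω = 0 := by
  unfold present
  rw [if_neg]
  refine fun h => hT ?_
  rintro ⟨x, a⟩ hx ⟨y, b⟩ hy hxy
  obtain rfl : x = y := hxy
  have h1 := h _ hx
  have h2 := h _ hy
  simp only at h1 h2
  rw [← h1, ← h2]

/-- Once the coordinate `h` is split off, `g` is constant along it, and one of its `h.1.1.val` equal
terms is selected. -/
theorem sum_ite_smul_eq {V : Type*} [AddCommGroup V] [Module ℝ V] (h : HalfEdge m n)
    (a : Fin h.1.1.val) (g : Outcome m n → V)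
    (hg : ∀ ω ω', (∀ h', h' ≠ h → ω h' = ω' h') → g ω = g ω') :
    ∑ ω : Outcome m n, (if ω h = a then (1 : ℝ) else 0) • g ω =
      (1 / (h.1.1.val : ℝ)) • ∑ ω, g ω := by
  classical
  rw [← (Equiv.piSplitAt h fun h : HalfEdge m n => Fin h.1.1.val).symm.sum_comp,
    ← (Equiv.piSplitAt h fun h : HalfEdge m n => Fin h.1.1.val).symm.sum_comp,
    Fintype.sum_prod_type_right, Fintype.sum_prod_type_right, Finset.smul_sum]
  refine Finset.sum_congr rfl fun w _ => ?_
  have h1 : ∀ b, (Equiv.piSplitAt h fun h : HalfEdge m n => Fin h.1.1.val).symm (b, w) h = b :=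
    fun b => by simp [Equiv.piSplitAt]
  have h2 : ∀ b, g ((Equiv.piSplitAt h fun h : HalfEdge m n => Fin h.1.1.val).symm (b, w)) =
      g ((Equiv.piSplitAt h fun h : HalfEdge m n => Fin h.1.1.val).symm (a, w)) := fun b =>
    hg _ _ fun h' hh' => by simp [Equiv.piSplitAt, hh']
  have hpos : (h.1.1.val : ℝ) ≠ 0 := by exact_mod_cast h.1.2.ne'
  simp only [h1, h2, ← Finset.sum_smul]
  rw [Finset.sum_ite_eq' Finset.univ a, Finset.sum_const, Finset.card_univ, Fintype.card_fin,
    ← Nat.cast_smul_eq_nsmul ℝ, smul_smul]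
  simp [hpos]

theorem sum_present_smul_eq {V : Type*} [AddCommGroup V] [Module ℝ V] (T : Finset (Edge m n))
    (hT : Set.InjOn Sigma.fst (T : Set (Edge m n))) (g : Outcome m n → V)
    (hg : ∀ ω ω', (∀ h, (∀ x ∈ T, x.1 ≠ h) → ω h = ω' h) → g ω = g ω') :
    ∑ ω, present T ω • g ω = (∏ x ∈ T, edgeWeight x) • ∑ ω, g ω := by
  classical
  induction T using Finset.induction_on with
  | empty => simp [present]
  | insert x T hx ih =>
    have hins : ∀ y ∈ T, y.1 ≠ x.1 := fun y hy hyx => hx (by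
      rwa [← hT (Finset.mem_coe.2 (Finset.mem_insert_of_mem hy))
        (Finset.mem_coe.2 (Finset.mem_insert_self x T)) hyx])
    have e : ∀ ω, present (insert x T) ω • g ω =
        (if ω x.1 = x.2 then (1 : ℝ) else 0) • (present T ω • g ω) := fun ω => by
      rw [Finset.insert_eq, present_union, mul_smul]
      simp [present]
    simp only [e]
    rw [sum_ite_smul_eq, ih (hT.mono (by simp)), smul_smul, Finset.prod_insert hx]
    · rfl
    · intro ω ω' h
      exact hg ω ω' fun h' hh' => h h' fun y hy => hh' y (Finset.mem_insert_of_mem hy)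
    · intro ω ω' h
      rw [present_congr fun y hy => h _ (hins y hy), hg ω ω' fun h' hh' =>
        h h' (hh' x (Finset.mem_insert_self x T)).symm]

/-- The probability that all the edges of `T` are present. -/
noncomputable def presentProb (T : Finset (Edge m n)) : ℝ :=
  ∑ ω, (law m n).real {ω} * present T ω

theorem sum_law_present_smul_eq {V : Type*} [AddCommGroup V] [Module ℝ V] (T : Finset (Edge m n))
    (hT : Set.InjOn Sigma.fst (T : Set (Edge m n))) (g : Outcome m n → V)
    (hg : ∀ ω ω', (∀ h, (∀ x ∈ T, x.1 ≠ h) → ω h = ω' h) → g ω = g ω') :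
    ∑ ω, ((law m n).real {ω} * present T ω) • g ω =
      (∏ x ∈ T, edgeWeight x) • ∑ ω, (law m n).real {ω} • g ω := by
  simp only [law_real_singleton, mul_smul, ← Finset.smul_sum]
  rw [sum_present_smul_eq T hT g hg, smul_comm]

theorem presentProb_eq {T : Finset (Edge m n)} (hT : Set.InjOn Sigma.fst (T : Set (Edge m n))) :
    presentProb T = ∏ x ∈ T, edgeWeight x := by
  have := sum_law_present_smul_eq T hT (fun _ => (1 : ℝ)) fun _ _ _ => rfl
  simpa [presentProb, sum_law_real_singleton] using this

theorem presentProb_eq_zero {T : Finset (Edge m n)}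
    (hT : ¬Set.InjOn Sigma.fst (T : Set (Edge m n))) : presentProb T = 0 :=
  Finset.sum_eq_zero fun ω _ => by rw [present_eq_zero_of_not_injOn hT, mul_zero]

theorem presentProb_nonneg (T : Finset (Edge m n)) : 0 ≤ presentProb T :=
  Finset.sum_nonneg fun _ _ => mul_nonneg measureReal_nonneg (present_nonneg _ _)

theorem presentProb_le (T : Finset (Edge m n)) : presentProb T ≤ ∏ x ∈ T, edgeWeight x := by
  by_cases hT : Set.InjOn Sigma.fst (T : Set (Edge m n))
  · exact (presentProb_eq hT).le
  · rw [presentProb_eq_zero hT]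
    exact Finset.prod_nonneg fun x _ => edgeWeight_nonneg x

/-- Independence for vector-valued `g`, as needed with values in the shift algebra. If `T` uses a
half-edge twice, both sides vanish. -/
theorem sum_law_present_smul {V : Type*} [AddCommGroup V] [Module ℝ V] (T : Finset (Edge m n))
    (g : Outcome m n → V)
    (hg : ∀ ω ω', (∀ h, (∀ x ∈ T, x.1 ≠ h) → ω h = ω' h) → g ω = g ω') :
    ∑ ω, ((law m n).real {ω} * present T ω) • g ω =
      presentProb T • ∑ ω, (law m n).real {ω} • g ω := by
  by_cases hT : Set.InjOn Sigma.fst (T : Set (Edge m n))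
  · rw [presentProb_eq hT, sum_law_present_smul_eq T hT g hg]
  · simp [presentProb_eq_zero hT, present_eq_zero_of_not_injOn hT]

end Law

/-! ### Cycles of the complete multigraph and their weights. -/

section Cycles

variable {m n : ℕ}

theorem val_eq_max_of_ends {x : Edge m n} {u v : Fin n} (h : ends x = s(u, v)) :
    x.1.1.1.val = max u.val v.val := by
  have hlt := x.2.isLt
  rw [ends, Sym2.eq_iff] at h
  rcases h with ⟨rfl, rfl⟩ | ⟨rfl, rfl⟩
  · exact (max_eq_left hlt.le).symm
  · exact (max_eq_right hlt.le).symm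

/-- With vertices counted from `0`, vertex `j ≥ 1` has `j` choices, and `1 / j ≤ 2 / (j + 1)`: hence
the `2` in the kernel. -/
theorem edgeWeight_le_edgeKernel {x : Edge m n} {u v : Fin n} (h : ends x = s(u, v)) :
    edgeWeight x ≤ edgeKernel n u v := by
  rw [edgeWeight, edgeKernel, ← val_eq_max_of_ends h]
  have h1 : (1 : ℝ) ≤ x.1.1.1.val := by exact_mod_cast x.1.1.2
  rw [div_le_div_iff₀ (by linarith) (by linarith)]
  linarith

/-- An edge is determined by its endpoints and its label. -/
theorem edge_ext {x y : Edge m n} (h : ends x = ends y) (hl : x.1.2 = y.1.2) : x = y := by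
  obtain ⟨⟨⟨j, hj⟩, a⟩, i⟩ := x
  obtain ⟨⟨⟨j', hj'⟩, a'⟩, i'⟩ := y
  simp only at hl
  subst hl
  have hj0 := val_eq_max_of_ends h
  have hi := i.isLt
  have hi' := i'.isLt
  simp only [ends, Sym2.eq_iff, Fin.ext_iff, Fin.val_castLE] at h hj0 hi hi'
  have h1 : j.val = j'.val := by omega
  obtain rfl := Fin.ext h1
  have h2 : i.val = i'.val := by omega
  obtain rfl := Fin.ext h2
  rfl

/-- A parametrization of a cycle of length `k + 2` by its vertices and its edges. -/
structure IsCycleParam (k : ℕ) (v : Fin (k + 2) → Fin n) (e : Fin (k + 2) → Edge m n)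
    (F : Finset (Edge m n)) : Prop where
  v_inj : Function.Injective v
  e_inj : Function.Injective e
  ends_eq : ∀ i, ends (e i) = s(v i, v (i + 1))
  range_eq : Set.range e = (F : Set (Edge m n))

/-- `ZMod (k + 2)` unfolds to `Fin (k + 2)`. -/
theorem isCycleEdgeSet_iff {k : ℕ} {F : Finset (Edge m n)} :
    IsCycleEdgeSet ends (k + 2) F ↔ ∃ v e, IsCycleParam k v e F :=
  ⟨fun ⟨v, e, h1, h2, h3, h4⟩ => ⟨v, e, h1, h2, h3, h4⟩,
    fun ⟨v, e, h⟩ => ⟨v, e, h.v_inj, h.e_inj, h.ends_eq, h.range_eq⟩⟩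

namespace IsCycleParam

variable {k : ℕ} {v : Fin (k + 2) → Fin n} {e : Fin (k + 2) → Edge m n} {F : Finset (Edge m n)}

theorem mem_iff (h : IsCycleParam k v e F) {x : Edge m n} : x ∈ F ↔ ∃ i, e i = x := by
  rw [← Finset.mem_coe, ← h.range_eq, Set.mem_range]

theorem mem (h : IsCycleParam k v e F) (i : Fin (k + 2)) : e i ∈ F := h.mem_iff.2 ⟨i, rfl⟩

theorem eq_image [DecidableEq (Edge m n)] (h : IsCycleParam k v e F) :
    F = Finset.univ.image e := by
  ext x; simp [h.mem_iff]

theorem card_eq (h : IsCycleParam k v e F) : F.card = k + 2 := by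
  classical
  rw [h.eq_image, Finset.card_image_of_injective _ h.e_inj, Finset.card_univ, Fintype.card_fin]

theorem prod_eq (h : IsCycleParam k v e F) (f : Edge m n → ℝ) : ∏ x ∈ F, f x = ∏ i, f (e i) := by
  classical
  rw [h.eq_image, Finset.prod_image h.e_inj.injOn]

theorem rotate (h : IsCycleParam k v e F) (i₀ : Fin (k + 2)) :
    IsCycleParam k (fun i => v (i + i₀)) (fun i => e (i + i₀)) F where
  v_inj := h.v_inj.comp (add_left_injective i₀)
  e_inj := h.e_inj.comp (add_left_injective i₀)
  ends_eq i := by rw [h.ends_eq, add_right_comm]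
  range_eq := by
    rw [← h.range_eq]
    exact (Equiv.addRight i₀).surjective.range_comp e

theorem exists_eq_of_mem_ends (h : IsCycleParam k v e F) {x : Edge m n} (hx : x ∈ F) {u : Fin n}
    (hu : u ∈ ends x) : ∃ i, v i = u := by
  obtain ⟨i, rfl⟩ := h.mem_iff.1 hx
  rw [h.ends_eq, Sym2.mem_iff] at hu
  rcases hu with rfl | rfl
  exacts [⟨_, rfl⟩, ⟨_, rfl⟩]

theorem eq_of_labels {F' : Finset (Edge m n)} {e' : Fin (k + 2) → Edge m n}
    (h : IsCycleParam k v e F) (h' : IsCycleParam k v e' F') (hl : ∀ i, (e i).1.2 = (e' i).1.2) :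
    F = F' := by
  classical
  have : e = e' := funext fun i => edge_ext (by rw [h.ends_eq, h'.ends_eq]) (hl i)
  rw [h.eq_image, h'.eq_image, this]

end IsCycleParam

theorem forall_of_cyclic_step {k : ℕ} {p : Fin (k + 2) → Prop} (h : ∀ i, p i → p (i + 1))
    {i₀ : Fin (k + 2)} (h₀ : p i₀) (j : Fin (k + 2)) : p j := by
  have key : ∀ t, p (i₀ + t) := fun t => by
    induction t using Fin.induction with
    | zero => simpa using h₀
    | succ t ih =>
      have := h _ ih
      rwa [add_assoc, Fin.coeSucc_eq_succ] at this
  have := key (j - i₀)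
  rwa [add_sub_cancel] at this

/-- A cycle contained in another one is equal to it. -/
theorem IsCycleParam.eq_of_subset {k k' : ℕ} {v : Fin (k + 2) → Fin n}
    {e : Fin (k + 2) → Edge m n} {v' : Fin (k' + 2) → Fin n} {e' : Fin (k' + 2) → Edge m n}
    {F F' : Finset (Edge m n)} (h : IsCycleParam k v e F) (h' : IsCycleParam k' v' e' F')
    (hsub : F' ⊆ F) : F' = F := by
  -- At `v (i + 1)` the larger cycle has only the edges `e i` and `e (i + 1)`. The smaller cycle has
  -- two distinct edges there, hence both.
  have step : ∀ i, e i ∈ F' → e (i + 1) ∈ F' := fun i hi => by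
    have hu : v (i + 1) ∈ ends (e i) := by rw [h.ends_eq]; exact Sym2.mem_mk_right _ _
    obtain ⟨t, ht⟩ := h'.exists_eq_of_mem_ends hi hu
    have hin : ∀ s, v (i + 1) ∈ ends (e' s) → e' s = e i ∨ e' s = e (i + 1) := fun s hs => by
      obtain ⟨a, ha⟩ := h.mem_iff.1 (hsub (h'.mem s))
      rw [← ha, h.ends_eq, Sym2.mem_iff] at hs
      rcases hs with hs | hs
      · right; rw [← ha, h.v_inj hs]
      · left; rw [← ha, add_right_cancel (h.v_inj hs)]
    have h1 := hin t (by rw [h'.ends_eq, ht]; exact Sym2.mem_mk_left _ _)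
    have h2 := hin (t - 1) (by rw [h'.ends_eq, sub_add_cancel, ht]; exact Sym2.mem_mk_right _ _)
    have hne : e' t ≠ e' (t - 1) := fun heq => by
      have := h'.e_inj heq
      rw [eq_comm, sub_eq_self] at this
      exact one_ne_zero this
    rcases h1 with h1 | h1
    · rcases h2 with h2 | h2
      · exact absurd (h1.trans h2.symm) hne
      · rw [← h2]; exact h'.mem _
    · rw [← h1]; exact h'.mem _
  obtain ⟨i₀, hi₀⟩ := h.mem_iff.1 (hsub (h'.mem 0))
  refine Finset.Subset.antisymm hsub fun x hx => ?_
  obtain ⟨i, rfl⟩ := h.mem_iff.1 hx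
  exact forall_of_cyclic_step step (i₀ := i₀) (by rw [hi₀]; exact h'.mem 0) i

/-- Sums over cycles are bounded by sums over vertex sequences. -/
theorem sum_cycle_le {k : ℕ} (S : Finset (Finset (Edge m n))) (f : Finset (Edge m n) → ℝ)
    (w : (Fin (k + 2) → Fin n) → ℝ) (hw : ∀ v, 0 ≤ w v)
    (h : ∀ F ∈ S, ∃ v e, IsCycleParam k v e F ∧ f F ≤ w v) :
    ∑ F ∈ S, f F ≤ m ^ (k + 2) * ∑ v, w v := by
  classical
  choose v e hp hf using h
  -- Vertices and labels determine the cycle; the labels account for the factor `m ^ (k + 2)`.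
  let φ : S → (Fin (k + 2) → Fin n) × (Fin (k + 2) → Fin m) :=
    fun F => (v F F.2, fun i => (e F F.2 i).1.2)
  have hφ : Function.Injective φ := fun F F' hFF' => by
    obtain ⟨h1, h2⟩ := Prod.mk.inj hFF'
    have hq := hp F' F'.2
    rw [← h1] at hq
    exact Subtype.ext ((hp F F.2).eq_of_labels hq fun i => congrFun h2 i)
  calc ∑ F ∈ S, f F = ∑ F : S, f F := (Finset.sum_coe_sort S f).symm
    _ ≤ ∑ F : S, w (φ F).1 := Finset.sum_le_sum fun F _ => hf F F.2
    _ = ∑ x ∈ Finset.univ.image φ, w x.1 :=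
        (Finset.sum_image (f := fun x => w x.1) hφ.injOn).symm
    _ ≤ ∑ x : (Fin (k + 2) → Fin n) × (Fin (k + 2) → Fin m), w x.1 :=
        Finset.sum_le_sum_of_subset_of_nonneg (Finset.subset_univ _) fun x _ _ => hw x.1
    _ = _ := by
        rw [Fintype.sum_prod_type_right]
        simp

/-- The vertices of a set of edges. -/
noncomputable def verts (F : Finset (Edge m n)) : Finset (Fin n) :=
  open Classical in Finset.univ.filter fun u => ∃ x ∈ F, u ∈ ends x

theorem mem_verts {F : Finset (Edge m n)} {u : Fin n} : u ∈ verts F ↔ ∃ x ∈ F, u ∈ ends x := by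
  simp [verts]

theorem IsCycleParam.card_verts_le {k : ℕ} {v : Fin (k + 2) → Fin n} {e : Fin (k + 2) → Edge m n}
    {F : Finset (Edge m n)} (h : IsCycleParam k v e F) : (verts F).card ≤ k + 2 := by
  classical
  have : verts F ⊆ Finset.univ.image v := fun u hu => by
    obtain ⟨x, hx, hux⟩ := mem_verts.1 hu
    obtain ⟨i, hi⟩ := h.exists_eq_of_mem_ends hx hux
    exact Finset.mem_image.2 ⟨i, Finset.mem_univ _, hi⟩
  refine (Finset.card_le_card this).trans (Finset.card_image_le.trans ?_)
  simp

/-- The total weight of the cycles through a vertex. -/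
theorem sum_weight_cycles_through_le (k : ℕ) (u : Fin n) (S : Finset (Finset (Edge m n)))
    (hS : ∀ F ∈ S, IsCycleEdgeSet ends (k + 2) F ∧ u ∈ verts F) :
    ∑ F ∈ S, ∏ x ∈ F, edgeWeight x ≤ m ^ (k + 2) * (2 * 8 ^ (k + 1)) * (1 / (u.val + 1)) := by
  rw [mul_assoc]
  refine (sum_cycle_le S _ (fun v => (if v 0 = u then 1 else 0) *
      (∏ i : Fin (k + 1), edgeKernel n (v i.castSucc) (v i.succ)) *
        edgeKernel n (v (Fin.last (k + 1))) u) (fun v => ?_) fun F hF => ?_).trans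
    (mul_le_mul_of_nonneg_left (sum_closed_walk_le (k + 1) u) (by positivity))
  · refine mul_nonneg (mul_nonneg (by split_ifs <;> norm_num) (Finset.prod_nonneg fun i _ =>
      edgeKernel_nonneg _ _)) (edgeKernel_nonneg _ _)
  · obtain ⟨hc, hu⟩ := hS F hF
    obtain ⟨v, e, h⟩ := isCycleEdgeSet_iff.1 hc
    obtain ⟨x, hx, hux⟩ := mem_verts.1 hu
    obtain ⟨i₀, hi₀⟩ := h.exists_eq_of_mem_ends hx hux
    have h' := h.rotate i₀
    refine ⟨_, _, h', ?_⟩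
    rw [h'.prod_eq]
    simp only [zero_add, hi₀, if_true, one_mul]
    rw [Fin.prod_univ_castSucc]
    refine mul_le_mul (Finset.prod_le_prod (fun i _ => edgeWeight_nonneg _) fun i _ => ?_) ?_
      (edgeWeight_nonneg _) (Finset.prod_nonneg fun i _ => edgeKernel_nonneg _ _)
    · refine edgeWeight_le_edgeKernel ?_
      have := h'.ends_eq i.castSucc
      rwa [Fin.coeSucc_eq_succ] at this
    · refine edgeWeight_le_edgeKernel ?_
      have := h'.ends_eq (Fin.last (k + 1))
      rwa [Fin.last_add_one, zero_add, hi₀] at this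

/-- The total conditional weight of the cycles that share some but not all of their edges with a
given set of edges. -/
theorem sum_weight_cycles_sharing_le [DecidableEq (Edge m n)] (k : ℕ) (T : Finset (Edge m n))
    {L : ℝ} (hL : (verts T).card ≤ L) (S : Finset (Finset (Edge m n)))
    (hS : ∀ F ∈ S, IsCycleEdgeSet ends (k + 2) F ∧ (∃ x ∈ F, x ∈ T) ∧ ¬F ⊆ T) :
    ∑ F ∈ S, ∏ x ∈ F \ T, edgeWeight x ≤
      m ^ (k + 2) * (10 * (10 + L + L ^ 2) ^ k * L) * ∑ z ∈ verts T, 1 / (z.val + 1 : ℝ) := by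
  rw [mul_assoc]
  refine (sum_cycle_le S _ (fun v => (if v 0 ∈ verts T then 1 else 0) *
      (edgeKernel n (v 0) (v 1) * ∏ i : Fin k, (edgeKernel n (v i.succ.castSucc) (v i.succ.succ) +
        if v i.succ.castSucc ∈ verts T ∧ v i.succ.succ ∈ verts T then 1 else 0)) *
      (if v (Fin.last (k + 1)) ∈ verts T then 1 else 0)) (fun v => ?_) fun F hF => ?_).trans
    (mul_le_mul_of_nonneg_left (sum_walk_to_set_le k (verts T) hL) (by positivity))
  · refine mul_nonneg (mul_nonneg (by split_ifs <;> norm_num) (mul_nonneg (edgeKernel_nonneg _ _)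
      (Finset.prod_nonneg fun i _ => ?_))) (by split_ifs <;> norm_num)
    exact add_nonneg (edgeKernel_nonneg _ _) (by split_ifs <;> norm_num)
  · obtain ⟨hc, ⟨x, hxF, hxT⟩, hsub⟩ := hS F hF
    obtain ⟨v, e, h⟩ := isCycleEdgeSet_iff.1 hc
    -- The cycle meets `T` without lying in it, so somewhere it leaves `T`. Rotated to that place,
    -- its first edge is outside `T` and is charged, while its last edge is in `T` and free; the
    -- walk between them starts and ends in `verts T`.
    obtain ⟨i₁, hi₁, hi₁'⟩ : ∃ i, e i ∈ T ∧ e (i + 1) ∉ T := by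
      by_contra hcon
      push Not at hcon
      obtain ⟨i₀, rfl⟩ := h.mem_iff.1 hxF
      refine hsub fun y hy => ?_
      obtain ⟨j, rfl⟩ := h.mem_iff.1 hy
      exact forall_of_cyclic_step (p := fun i => e i ∈ T) hcon hxT j
    obtain ⟨v', e', h', he0, helast⟩ : ∃ v' e', IsCycleParam k v' e' F ∧ e' 0 ∉ T ∧
        e' (Fin.last (k + 1)) ∈ T := by
      refine ⟨_, _, h.rotate (i₁ + 1), ?_, ?_⟩
      · rwa [zero_add]
      · rwa [add_comm i₁ 1, ← add_assoc, Fin.last_add_one, zero_add]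
    refine ⟨v', e', h', ?_⟩
    have hprod : ∏ x ∈ F \ T, edgeWeight x = ∏ x ∈ F, if x ∈ T then 1 else edgeWeight x := by
      rw [Finset.sdiff_eq_filter, Finset.prod_filter]
      exact Finset.prod_congr rfl fun x _ => by by_cases hx : x ∈ T <;> simp [hx]
    rw [hprod, h'.prod_eq]
    have hvmem : ∀ i, e' i ∈ T → v' i ∈ verts T ∧ v' (i + 1) ∈ verts T := fun i hi =>
      ⟨mem_verts.2 ⟨_, hi, by rw [h'.ends_eq]; exact Sym2.mem_mk_left _ _⟩,
        mem_verts.2 ⟨_, hi, by rw [h'.ends_eq]; exact Sym2.mem_mk_right _ _⟩⟩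
    have hl := hvmem _ helast
    rw [Fin.last_add_one] at hl
    rw [if_pos hl.1, if_pos hl.2, mul_one, one_mul, Fin.prod_univ_castSucc, if_pos helast, mul_one,
      Fin.prod_univ_succ, Fin.castSucc_zero, if_neg he0]
    refine mul_le_mul ?_ (Finset.prod_le_prod (fun i _ => ?_) fun i _ => ?_)
      (Finset.prod_nonneg fun i _ => ?_) (edgeKernel_nonneg _ _)
    · exact edgeWeight_le_edgeKernel (by rw [h'.ends_eq, zero_add])
    · split_ifs
      exacts [zero_le_one, edgeWeight_nonneg _]
    · have hs := hvmem i.succ.castSucc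
      have hw := edgeWeight_le_edgeKernel (h'.ends_eq i.succ.castSucc)
      have h0 := edgeKernel_nonneg (v' i.succ.castSucc) (v' (i.succ.castSucc + 1))
      rw [Fin.coeSucc_eq_succ] at hs hw h0
      by_cases hT : e' i.succ.castSucc ∈ T
      · rw [if_pos hT, if_pos (hs hT)]; linarith
      · rw [if_neg hT]
        refine hw.trans (le_add_of_nonneg_right ?_)
        split_ifs <;> norm_num
    · split_ifs
      exacts [zero_le_one, edgeWeight_nonneg _]

end Cycles

end UniformAttachment

namespace UniformAttachment

/-! ### Logarithmic lower bound for the means. -/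

section Mean

/-- The edge sets of the `ℓ`-cycles of the `m`-fold complete multigraph. -/
noncomputable def cycles (m n ℓ : ℕ) : Finset (Finset (Edge m n)) :=
  open Classical in Finset.univ.filter fun F => IsCycleEdgeSet ends ℓ F

variable {m n : ℕ}

theorem mem_cycles {ℓ : ℕ} {F : Finset (Edge m n)} :
    F ∈ cycles m n ℓ ↔ IsCycleEdgeSet ends ℓ F := by
  simp [cycles]

theorem cycleCount_eq_sum (ℓ : ℕ) (ω : Outcome m n) :
    (cycleCount m n ℓ ω : ℝ) = ∑ F ∈ cycles m n ℓ, present F ω := by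
  classical
  have h : {F : Finset (Edge m n) | IsCycleEdgeSet ends ℓ F ∧ (F : Set (Edge m n)) ⊆ edgeSet ω} =
      ((cycles m n ℓ).filter fun F => ∀ x ∈ F, ω x.1 = x.2 : Finset (Finset (Edge m n))) := by
    ext F
    simp [mem_cycles, Set.subset_def, edgeSet]
  rw [cycleCount, h, Set.ncard_coe_finset, Finset.card_filter, Nat.cast_sum]
  refine Finset.sum_congr rfl fun F _ => ?_
  unfold present
  split_ifs <;> simp

theorem cycleMean_eq_sum_law (ℓ : ℕ) :
    (cycleMean m n ℓ : ℝ) = ∑ ω, (law m n).real {ω} * cycleCount m n ℓ ω := by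
  change ∫ ω, (cycleCount m n ℓ ω : ℝ) ∂(law m n) = _
  rw [integral_fintype Integrable.of_finite]
  rfl

theorem cycleMean_eq_sum (ℓ : ℕ) :
    (cycleMean m n ℓ : ℝ) = ∑ F ∈ cycles m n ℓ, presentProb F := by
  rw [cycleMean_eq_sum_law]
  simp only [cycleCount_eq_sum, Finset.mul_sum, presentProb]
  exact Finset.sum_comm

/-- The edge from `a` to `b` with label `l`. -/
def mkEdge (a b : Fin n) (h : b < a) (l : Fin m) : Edge m n :=
  ⟨⟨⟨a, (Nat.zero_le b.val).trans_lt h⟩, l⟩, ⟨b, h⟩⟩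

theorem mkEdge_inj {a b a' b' : Fin n} {h : b < a} {h' : b' < a'} {l l' : Fin m}
    (heq : mkEdge a b h l = mkEdge a' b' h' l') : a = a' ∧ b = b' ∧ l = l' := by
  have h1 : a = a' := congrArg (fun x => x.1.1.1) heq
  have h2 : l = l' := congrArg (fun x => x.1.2) heq
  have h3 : b.val = b'.val := congrArg (fun x => x.2.val) heq
  exact ⟨h1, Fin.ext h3, h2⟩

variable {k : ℕ} {v : Fin (k + 2) → Fin n}

theorem monotoneCycle_lt (hv : StrictAnti v) (i : Fin (k + 2)) :
    (if i = Fin.last (k + 1) then v i else v (i + 1)) <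
      (if i = Fin.last (k + 1) then v 0 else v i) := by
  split_ifs with h
  · rw [h]; exact hv (Fin.last_pos)
  · obtain ⟨j, rfl⟩ := Fin.exists_castSucc_eq.2 h
    rw [Fin.coeSucc_eq_succ]
    exact hv (Fin.castSucc_lt_succ)

/-- The edges of the cycle that runs through a decreasing sequence of vertices. -/
def monotoneCycleEdge (hm : 2 ≤ m) (hv : StrictAnti v) (i : Fin (k + 2)) : Edge m n :=
  mkEdge _ _ (monotoneCycle_lt hv i)
    (if i = Fin.last (k + 1) then ⟨1, hm⟩ else ⟨0, by omega⟩)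

/-- Only `v 0` is the later endpoint of two edges, and these carry different labels; here `m ≥ 2`
enters. -/
theorem monotoneCycleEdge_fst_injective (hm : 2 ≤ m) (hv : StrictAnti v) :
    Function.Injective fun i => (monotoneCycleEdge hm hv i).1 := by
  intro i j hij
  have h1 : (if i = Fin.last (k + 1) then v 0 else v i) =
      (if j = Fin.last (k + 1) then v 0 else v j) := congrArg (fun x => x.1.1) hij
  have h2 : (if i = Fin.last (k + 1) then (⟨1, hm⟩ : Fin m) else ⟨0, by omega⟩) =
      (if j = Fin.last (k + 1) then ⟨1, hm⟩ else ⟨0, by omega⟩) := congrArg (fun x => x.2) hij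
  split_ifs at h1 h2 with hi hj hj
  · rw [hi, hj]
  · simp at h2
  · simp at h2
  · exact hv.injective h1

/-- The cycle that runs through a decreasing sequence of vertices. -/
noncomputable def monotoneCycle (hm : 2 ≤ m) (hv : StrictAnti v) : Finset (Edge m n) :=
  open Classical in Finset.univ.image (monotoneCycleEdge hm hv)

theorem isCycleParam_monotoneCycle (hm : 2 ≤ m) (hv : StrictAnti v) :
    IsCycleParam k v (monotoneCycleEdge hm hv) (monotoneCycle hm hv) where
  v_inj := hv.injective
  e_inj i j h := monotoneCycleEdge_fst_injective hm hv (congrArg Sigma.fst h)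
  ends_eq i := by
    have : ends (monotoneCycleEdge hm hv i) = s(if i = Fin.last (k + 1) then v 0 else v i,
        if i = Fin.last (k + 1) then v i else v (i + 1)) := rfl
    rw [this]
    split_ifs with h
    · rw [h, Fin.last_add_one, Sym2.eq_swap]
    · rfl
  range_eq := by simp [monotoneCycle]

/-- The closing edge is the only one with label `1`, and its later endpoint is `v 0`; the edges with
label `0` then give the successors one by one. -/
theorem monotoneCycle_injective (hm : 2 ≤ m) {v' : Fin (k + 2) → Fin n} (hv : StrictAnti v)
    (hv' : StrictAnti v') (h : monotoneCycle hm hv = monotoneCycle hm hv') : v = v' := by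
  have hmem : ∀ i, ∃ j, monotoneCycleEdge hm hv' j = monotoneCycleEdge hm hv i := fun i =>
    (isCycleParam_monotoneCycle hm hv').mem_iff.1 (h ▸ (isCycleParam_monotoneCycle hm hv).mem i)
  funext i
  induction i using Fin.induction with
  | zero =>
    obtain ⟨j, hj⟩ := hmem (Fin.last (k + 1))
    obtain ⟨h1, -, h3⟩ := mkEdge_inj hj
    simp only [if_true] at h1 h3
    split_ifs at h1 h3 with hl
    · exact h1.symm
    · simp at h3
  | succ i ih =>
    obtain ⟨j, hj⟩ := hmem i.castSucc
    obtain ⟨h1, h2, h3⟩ := mkEdge_inj hj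
    have hi : i.castSucc ≠ Fin.last (k + 1) := (Fin.castSucc_lt_last i).ne
    simp only [if_neg hi] at h1 h2 h3
    split_ifs at h1 h2 h3 with hl
    · simp at h3
    · rw [ih] at h1
      rw [hv'.injective h1, Fin.coeSucc_eq_succ] at h2
      exact h2.symm

theorem inv_pow_le_presentProb_monotoneCycle (hm : 2 ≤ m) (hv : StrictAnti v) :
    (1 / ((v 0).val : ℝ)) ^ (k + 2) ≤ presentProb (monotoneCycle hm hv) := by
  have hp := isCycleParam_monotoneCycle hm hv
  rw [presentProb_eq, hp.prod_eq]
  · calc (1 / ((v 0).val : ℝ)) ^ (k + 2) = ∏ _i : Fin (k + 2), (1 / ((v 0).val : ℝ)) := by simp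
      _ ≤ _ := by
        refine Finset.prod_le_prod (fun i _ => by positivity) fun i _ => ?_
        have hpos : 0 < (monotoneCycleEdge hm hv i).1.1.1.val := (monotoneCycleEdge hm hv i).1.1.2
        have hle : (monotoneCycleEdge hm hv i).1.1.1 ≤ v 0 := by
          change (if i = Fin.last (k + 1) then v 0 else v i) ≤ v 0
          split_ifs
          · exact le_rfl
          · exact hv.antitone (Fin.zero_le i)
        exact one_div_le_one_div_of_le (by exact_mod_cast hpos) (by exact_mod_cast hle)
  · intro x hx y hy hxy
    obtain ⟨i, rfl⟩ := hp.mem_iff.1 (Finset.mem_coe.1 hx)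
    obtain ⟨j, rfl⟩ := hp.mem_iff.1 (Finset.mem_coe.1 hy)
    rw [monotoneCycleEdge_fst_injective hm hv hxy]

theorem sum_strictAnti_le_cycleMean (hm : 2 ≤ m) (S : Finset (Fin (k + 2) → Fin n))
    (hS : ∀ v ∈ S, StrictAnti v) :
    ∑ v ∈ S, (1 / ((v 0).val : ℝ)) ^ (k + 2) ≤ cycleMean m n (k + 2) := by
  classical
  rw [cycleMean_eq_sum, ← Finset.sum_coe_sort]
  have hinj : Function.Injective fun v : S => monotoneCycle hm (hS v v.2) := fun v v' h =>
    Subtype.ext (monotoneCycle_injective hm _ _ h)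
  calc _ ≤ ∑ v : S, presentProb (monotoneCycle hm (hS v v.2)) :=
        Finset.sum_le_sum fun v _ => inv_pow_le_presentProb_monotoneCycle hm _
    _ = ∑ F ∈ Finset.univ.image fun v : S => monotoneCycle hm (hS v v.2), presentProb F :=
        (Finset.sum_image hinj.injOn).symm
    _ ≤ _ := by
        refine Finset.sum_le_sum_of_subset_of_nonneg (fun F hF => ?_)
          fun F _ _ => presentProb_nonneg F
        obtain ⟨v, -, rfl⟩ := Finset.mem_image.1 hF
        exact mem_cycles.2 (isCycleEdgeSet_iff.2 ⟨_, _, isCycleParam_monotoneCycle hm (hS v v.2)⟩)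

/-- Below `j` there are `k + 1` disjoint blocks of `j / (k + 1)` vertices; one vertex is picked from
each, from the top block down. -/
theorem pow_le_card_strictAnti (k : ℕ) (j : Fin n) :
    (j.val / (k + 1)) ^ (k + 1) ≤
      (Finset.univ.filter fun v : Fin (k + 2) → Fin n => StrictAnti v ∧ v 0 = j).card := by
  classical
  set b := j.val / (k + 1) with hb
  have hbj : (k + 1) * b ≤ j.val := Nat.mul_div_le _ _
  have hlt : ∀ (c : Fin (k + 1) → Fin b) (i : Fin (k + 1)), (k - i.val) * b + (c i).val < j.val :=
    fun c i => by
      have h1 := (c i).isLt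
      have h2 : (k - i.val) * b ≤ k * b := Nat.mul_le_mul_right _ (Nat.sub_le _ _)
      have h3 : (k + 1) * b = k * b + b := by ring
      omega
  let f : (Fin (k + 1) → Fin b) → Fin (k + 2) → Fin n := fun c =>
    Fin.cons j fun i => ⟨(k - i.val) * b + (c i).val, (hlt c i).trans j.isLt⟩
  have hcard : (Finset.univ : Finset (Fin (k + 1) → Fin b)).card = b ^ (k + 1) := by simp
  rw [← hcard]
  refine Finset.card_le_card_of_injOn f (fun c _ => ?_) ?_
  · simp only [Finset.coe_filter, Finset.mem_univ, true_and, Set.mem_ofPred_eq]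
    refine ⟨Fin.strictAnti_iff_succ_lt.2 fun i => ?_, rfl⟩
    refine Fin.cases ?_ (fun i => ?_) i
    · exact hlt c 0
    · rw [← Fin.succ_castSucc]
      simp only [f, Fin.cons_succ, Fin.lt_def, Fin.val_succ, Fin.val_castSucc]
      have h1 := (c i.succ).isLt
      have h2 : k - i.val = (k - (i.val + 1)) + 1 := by omega
      rw [h2, Nat.add_mul _ 1, one_mul]
      omega
  · intro c _ c' _ h
    funext i
    have := congrArg (fun v => (v i.succ).val) h
    simp only [f, Fin.cons_succ] at this
    exact Fin.ext (by omega)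

/-- The expected number of cycles is at least of order `log n`. -/
theorem log_le_cycleMean (hm : 2 ≤ m) (hn : 1 ≤ n) (k : ℕ) :
    (1 / (2 * (k + 1) : ℝ)) ^ (k + 1) * (Real.log n - (k + 1)) ≤ cycleMean m n (k + 2) := by
  classical
  set c : ℝ := (1 / (2 * (k + 1) : ℝ)) ^ (k + 1) with hc
  have hc0 : 0 ≤ c := by positivity
  set S : Finset (Fin (k + 2) → Fin n) := Finset.univ.filter StrictAnti
  have h1 := sum_strictAnti_le_cycleMean hm S fun v hv => (Finset.mem_filter.1 hv).2
  refine le_trans ?_ h1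
  rw [← Finset.sum_fiberwise S fun v => v 0]
  -- For `j < k + 1` the blocks are empty and the subtracted `1` makes the claim trivial, at a total
  -- cost of at most `k + 1`. For larger `j`, the floor `j / (k + 1)` is at least half the true
  -- quotient.
  have h2 : ∀ j : Fin n, c * (1 / (j.val : ℝ) - if j.val < k + 1 then 1 else 0) ≤
      ∑ v ∈ S with v 0 = j, (1 / ((v 0).val : ℝ)) ^ (k + 2) := fun j => by
    have e : ∑ v ∈ S with v 0 = j, (1 / ((v 0).val : ℝ)) ^ (k + 2) =
        (S.filter fun v => v 0 = j).card * (1 / (j.val : ℝ)) ^ (k + 2) := by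
      rw [← nsmul_eq_mul, ← Finset.sum_const]
      exact Finset.sum_congr rfl fun v hv => by rw [(Finset.mem_filter.1 hv).2]
    rw [e]
    split_ifs with hj
    · have : 1 / (j.val : ℝ) ≤ 1 := by
        rcases Nat.eq_zero_or_pos j.val with h0 | h0
        · simp [h0]
        · exact (div_le_one (by exact_mod_cast h0)).2 (by exact_mod_cast h0)
      exact (mul_nonpos_of_nonneg_of_nonpos hc0 (by linarith)).trans (by positivity)
    · have hj' : k + 1 ≤ j.val := not_lt.1 hj
      have hj0 : (0 : ℝ) < j.val := by exact_mod_cast (by omega : 0 < j.val)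
      have hcard := pow_le_card_strictAnti k j
      rw [← Finset.filter_filter] at hcard
      have hb1 : 1 ≤ j.val / (k + 1) := (Nat.one_le_div_iff (by omega)).2 hj'
      have hb2 : j.val < (k + 1) * (j.val / (k + 1) + 1) := Nat.lt_mul_div_succ _ (by omega)
      have hb : (j.val : ℝ) * (1 / (2 * (k + 1))) ≤ (j.val / (k + 1) : ℕ) := by
        rw [mul_one_div, div_le_iff₀ (by positivity)]
        have : j.val ≤ (j.val / (k + 1)) * (2 * (k + 1)) := by nlinarith
        exact_mod_cast this
      calc c * (1 / (j.val : ℝ) - 0) =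
            ((j.val : ℝ) * (1 / (2 * (k + 1)))) ^ (k + 1) * (1 / (j.val : ℝ)) ^ (k + 2) := by
            rw [hc, mul_pow, pow_succ (1 / (j.val : ℝ)) (k + 1), div_pow 1 (j.val : ℝ), one_pow]
            field_simp
            ring
        _ ≤ ((j.val / (k + 1) : ℕ) : ℝ) ^ (k + 1) * (1 / (j.val : ℝ)) ^ (k + 2) := by gcongr
        _ ≤ _ := by
            refine mul_le_mul_of_nonneg_right ?_ (by positivity)
            exact_mod_cast hcard
  refine le_trans ?_ (Finset.sum_le_sum fun j _ => h2 j)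
  rw [← Finset.mul_sum]
  refine mul_le_mul_of_nonneg_left ?_ hc0
  rw [Finset.sum_sub_distrib, Fin.sum_univ_eq_sum_range (fun j : ℕ => 1 / (j : ℝ)),
    Fin.sum_univ_eq_sum_range (fun j : ℕ => if j < k + 1 then (1 : ℝ) else 0)]
  refine sub_le_sub ?_ ?_
  · obtain ⟨n, rfl⟩ := Nat.exists_eq_add_of_le' hn
    refine (log_add_one_le_harmonic n).trans (le_of_eq ?_)
    rw [Finset.sum_range_succ', harmonic]
    push_cast
    simp
  · rw [← Finset.sum_filter, Finset.sum_const, nsmul_eq_mul, mul_one]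
    have : ((Finset.range n).filter fun j => j < k + 1).card ≤ (Finset.range (k + 1)).card :=
      Finset.card_le_card fun j hj => Finset.mem_range.2 (Finset.mem_filter.1 hj).2
    rw [Finset.card_range] at this
    exact_mod_cast this

end Mean

end UniformAttachment

namespace UniformAttachment

/-! ### Dependency neighbourhoods of cycles and the error terms. -/

section Approximation

/-- The product of the edge probabilities over a set of edges. -/
noncomputable def weight {m n : ℕ} (T : Finset (Edge m n)) : ℝ := ∏ x ∈ T, edgeWeight x

theorem weight_nonneg {m n : ℕ} (T : Finset (Edge m n)) : 0 ≤ weight T :=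
  Finset.prod_nonneg fun x _ => edgeWeight_nonneg x

/-- The sum of the inverses of the vertices of a set of edges. -/
noncomputable def invSum {m n : ℕ} (T : Finset (Edge m n)) : ℝ :=
  ∑ z ∈ verts T, 1 / (z.val + 1 : ℝ)

/-- The cycles of the lengths `ℓ i`. -/
abbrev CycleIndex {r : ℕ} (m n : ℕ) (ℓ : Fin r → ℕ) : Type := Σ i : Fin r, cycles m n (ℓ i)

/-- The constant in the bound for the total weight of the cycles through a vertex. -/
def throughConst {r : ℕ} (m : ℕ) (ℓ : Fin r → ℕ) : ℝ :=
  ∑ i, (m : ℝ) ^ ℓ i * (2 * 8 ^ (ℓ i - 1))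

/-- The constant in the bound for the total conditional weight of the cycles that share an edge with
a given cycle. -/
def sharingConst {r : ℕ} (m : ℕ) (ℓ : Fin r → ℕ) : ℝ :=
  ∑ i, (m : ℝ) ^ ℓ i *
    (10 * (10 + (∑ j, ℓ j : ℕ) + ((∑ j, ℓ j : ℕ) : ℝ) ^ 2) ^ (ℓ i - 2) * (∑ j, ℓ j : ℕ))

theorem throughConst_nonneg {r : ℕ} (m : ℕ) (ℓ : Fin r → ℕ) : 0 ≤ throughConst m ℓ :=
  Finset.sum_nonneg fun i _ => by positivity

theorem sharingConst_nonneg {r : ℕ} (m : ℕ) (ℓ : Fin r → ℕ) : 0 ≤ sharingConst m ℓ :=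
  Finset.sum_nonneg fun i _ => by positivity

variable {m n r : ℕ} {ℓ : Fin r → ℕ}

theorem exists_isCycleParam (hℓ : ∀ i, 2 ≤ ℓ i) (α : CycleIndex m n ℓ) :
    ∃ k v e, k + 2 = ℓ α.1 ∧ IsCycleParam k v e α.2.1 := by
  obtain ⟨i, F, hF⟩ := α
  obtain ⟨k, hk⟩ := Nat.exists_eq_add_of_le' (hℓ i)
  have h := mem_cycles.1 hF
  rw [hk] at h
  obtain ⟨v, e, h⟩ := isCycleEdgeSet_iff.1 h
  exact ⟨k, v, e, hk.symm, h⟩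

theorem sum_weight_through_le [DecidableEq (Fin n)] (hℓ : ∀ i, 2 ≤ ℓ i) (z : Fin n) :
    ∑ β : CycleIndex m n ℓ, (if z ∈ verts β.2.1 then weight β.2.1 else 0) ≤
      throughConst m ℓ * (1 / (z.val + 1)) := by
  rw [Fintype.sum_sigma, throughConst, Finset.sum_mul]
  refine Finset.sum_le_sum fun i _ => ?_
  rw [Finset.sum_coe_sort (cycles m n (ℓ i)) fun F => if z ∈ verts F then weight F else 0,
    ← Finset.sum_filter]
  obtain ⟨k, hk⟩ := Nat.exists_eq_add_of_le' (hℓ i)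
  rw [hk]
  exact sum_weight_cycles_through_le k z _ fun F hF =>
    ⟨mem_cycles.1 (Finset.mem_filter.1 hF).1, (Finset.mem_filter.1 hF).2⟩

/-- Exchanging the sums gives `∑ z, (1 / z) * O(1 / z)`; its convergence keeps the error terms
bounded in `n`. -/
theorem sum_weight_mul_invSum_le (hℓ : ∀ i, 2 ≤ ℓ i) :
    ∑ α : CycleIndex m n ℓ, weight α.2.1 * invSum α.2.1 ≤ 2 * throughConst m ℓ := by
  classical
  calc _ = ∑ z : Fin n, (1 / (z.val + 1 : ℝ)) *
        ∑ α : CycleIndex m n ℓ, (if z ∈ verts α.2.1 then weight α.2.1 else 0) := by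
        simp only [Finset.mul_sum]
        rw [Finset.sum_comm]
        refine Finset.sum_congr rfl fun α _ => ?_
        simp only [mul_ite, mul_zero, ← Finset.sum_filter, Finset.filter_univ_mem, invSum,
          Finset.mul_sum]
        exact Finset.sum_congr rfl fun z _ => mul_comm _ _
    _ ≤ ∑ z : Fin n, (1 / (z.val + 1 : ℝ)) * (throughConst m ℓ * (1 / (z.val + 1))) := by
        gcongr with z
        exact sum_weight_through_le hℓ z
    _ = throughConst m ℓ * ∑ z : Fin n, 1 / (z.val + 1 : ℝ) * (1 / (z.val + 1)) := by
        rw [Finset.mul_sum]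
        exact Finset.sum_congr rfl fun z _ => by ring
    _ ≤ _ := by
        rw [mul_comm 2]
        exact mul_le_mul_of_nonneg_left (sum_inv_sq_le n) (throughConst_nonneg m ℓ)

/-- The cycles that share a half-edge with a given cycle. -/
noncomputable def neighbourhood (α : CycleIndex m n ℓ) : Finset (CycleIndex m n ℓ) :=
  open Classical in Finset.univ.filter fun β => ∃ x ∈ α.2.1, ∃ y ∈ β.2.1, x.1 = y.1

theorem mem_neighbourhood {α β : CycleIndex m n ℓ} :
    β ∈ neighbourhood α ↔ ∃ x ∈ α.2.1, ∃ y ∈ β.2.1, x.1 = y.1 := by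
  simp [neighbourhood]

theorem mem_verts_of_fst_eq {T : Finset (Edge m n)} {x y : Edge m n} (hx : x ∈ T) (h : x.1 = y.1) :
    y.1.1.1 ∈ verts T :=
  mem_verts.2 ⟨x, hx, by rw [← h]; exact Sym2.mem_mk_left _ _⟩

/-- A neighbour contains the later endpoint of the common half-edge, so a union bound over the
vertices of `α` suffices. -/
theorem sum_presentProb_neighbourhood_le (hℓ : ∀ i, 2 ≤ ℓ i) (α : CycleIndex m n ℓ) :
    ∑ β ∈ neighbourhood α, presentProb β.2.1 ≤ throughConst m ℓ * invSum α.2.1 := by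
  classical
  calc _ ≤ ∑ β ∈ neighbourhood α,
        ∑ z ∈ verts α.2.1, (if z ∈ verts β.2.1 then weight β.2.1 else 0) := by
        refine Finset.sum_le_sum fun β hβ => (presentProb_le _).trans ?_
        obtain ⟨x, hx, y, hy, hxy⟩ := mem_neighbourhood.1 hβ
        refine le_trans ?_ (Finset.single_le_sum (f := fun z =>
          if z ∈ verts β.2.1 then weight β.2.1 else 0) (fun z _ => ?_) (mem_verts_of_fst_eq hx hxy))
        · rw [if_pos (mem_verts_of_fst_eq hy rfl)]
          exact le_rfl
        · split_ifs
          exacts [weight_nonneg _, le_rfl]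
    _ ≤ ∑ β : CycleIndex m n ℓ,
        ∑ z ∈ verts α.2.1, (if z ∈ verts β.2.1 then weight β.2.1 else 0) :=
        Finset.sum_le_sum_of_subset_of_nonneg (Finset.subset_univ _) fun β _ _ =>
          Finset.sum_nonneg fun z _ => by
            split_ifs
            exacts [weight_nonneg _, le_rfl]
    _ ≤ ∑ z ∈ verts α.2.1, throughConst m ℓ * (1 / (z.val + 1)) := by
        rw [Finset.sum_comm]
        exact Finset.sum_le_sum fun z _ => sum_weight_through_le hℓ z
    _ = _ := by rw [invSum, Finset.mul_sum]

/-- Cycles sharing a half-edge but no edge demand conflicting choices. Otherwise only the edges of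
`β` outside `α` cost anything further. -/
theorem joint_present_le [DecidableEq (Edge m n)] (α β : CycleIndex m n ℓ)
    (hβ : β ∈ neighbourhood α) :
    ∑ ω, (law m n).real {ω} * (present α.2.1 ω * present β.2.1 ω) ≤
      weight α.2.1 * if ∃ x ∈ β.2.1, x ∈ α.2.1 then weight (β.2.1 \ α.2.1) else 0 := by
  have e : ∑ ω, (law m n).real {ω} * (present α.2.1 ω * present β.2.1 ω) =
      presentProb (α.2.1 ∪ β.2.1) := by simp only [presentProb, present_union]
  rw [e]
  split_ifs with h
  · refine (presentProb_le _).trans (le_of_eq ?_)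
    rw [weight, weight, ← Finset.prod_union Finset.disjoint_sdiff, Finset.union_sdiff_self_eq_union]
  · rw [presentProb_eq_zero, mul_zero]
    intro hinj
    obtain ⟨x, hx, y, hy, hxy⟩ := mem_neighbourhood.1 hβ
    have : x = y := hinj (Finset.mem_coe.2 (Finset.mem_union_left _ hx))
      (Finset.mem_coe.2 (Finset.mem_union_right _ hy)) hxy
    exact h ⟨y, hy, this ▸ hx⟩

/-- Nested cycles coincide and so have equal length; as the lengths `ℓ i` are distinct, the indices
coincide too. -/
theorem not_subset_of_ne (hℓ : ∀ i, 2 ≤ ℓ i) (hinj : ∀ i j, i ≠ j → ℓ i ≠ ℓ j)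
    {α β : CycleIndex m n ℓ} (h : β ≠ α) : ¬β.2.1 ⊆ α.2.1 := by
  intro hsub
  obtain ⟨k, v, e, hk, hα⟩ := exists_isCycleParam hℓ α
  obtain ⟨k', v', e', hk', hβ⟩ := exists_isCycleParam hℓ β
  have heq := hα.eq_of_subset hβ hsub
  have hcard : ℓ β.1 = ℓ α.1 := by
    rw [← hk, ← hk', ← hα.card_eq, ← hβ.card_eq, heq]
  have hij : β.1 = α.1 := by
    by_contra hne
    exact hinj _ _ hne hcard
  obtain ⟨i, F, hF⟩ := α
  obtain ⟨j, F', hF'⟩ := β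
  simp only at hij heq
  subst hij heq
  exact h rfl

theorem sum_joint_present_le [DecidableEq (CycleIndex m n ℓ)] (hℓ : ∀ i, 2 ≤ ℓ i)
    (hinj : ∀ i j, i ≠ j → ℓ i ≠ ℓ j) (α : CycleIndex m n ℓ) :
    ∑ β ∈ (neighbourhood α).erase α,
      ∑ ω, (law m n).real {ω} * (present α.2.1 ω * present β.2.1 ω) ≤
      weight α.2.1 * (sharingConst m ℓ * invSum α.2.1) := by
  classical
  obtain ⟨k, v, e, hk, hα⟩ := exists_isCycleParam hℓ α
  have hcard : ((verts α.2.1).card : ℝ) ≤ (∑ j, ℓ j : ℕ) := by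
    refine Nat.cast_le.2 (hα.card_verts_le.trans ?_)
    rw [hk]
    exact Finset.single_le_sum (fun _ _ => Nat.zero_le _) (Finset.mem_univ α.1)
  let Q : Finset (Edge m n) → Prop := fun F => (∃ x ∈ F, x ∈ α.2.1) ∧ ¬F ⊆ α.2.1
  calc _ ≤ ∑ β ∈ (neighbourhood α).erase α, weight α.2.1 *
        if Q β.2.1 then weight (β.2.1 \ α.2.1) else 0 := by
        refine Finset.sum_le_sum fun β hβ => ?_
        obtain ⟨hne, hN⟩ := Finset.mem_erase.1 hβ
        refine (joint_present_le α β hN).trans (le_of_eq ?_)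
        simp only [Q, not_subset_of_ne hℓ hinj hne, not_false_iff, and_true]
    _ ≤ ∑ β : CycleIndex m n ℓ, weight α.2.1 *
        if Q β.2.1 then weight (β.2.1 \ α.2.1) else 0 := by
        refine Finset.sum_le_sum_of_subset_of_nonneg (Finset.subset_univ _) fun β _ _ =>
          mul_nonneg (weight_nonneg _) ?_
        split_ifs
        exacts [weight_nonneg _, le_rfl]
    _ ≤ _ := by
        rw [← Finset.mul_sum]
        refine mul_le_mul_of_nonneg_left ?_ (weight_nonneg _)
        rw [Fintype.sum_sigma, sharingConst, Finset.sum_mul]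
        refine Finset.sum_le_sum fun i _ => ?_
        rw [Finset.sum_coe_sort (cycles m n (ℓ i)) fun F =>
          if Q F then weight (F \ α.2.1) else 0, ← Finset.sum_filter]
        obtain ⟨k, hk⟩ := Nat.exists_eq_add_of_le' (hℓ i)
        have := sum_weight_cycles_sharing_le k α.2.1 hcard
          ((cycles m n (ℓ i)).filter Q) fun F hF => by
            obtain ⟨h1, h2⟩ := Finset.mem_filter.1 hF
            exact ⟨hk ▸ mem_cycles.1 h1, h2⟩
        rw [hk] at this ⊢
        exact this

/-- The approximation error in terms of a lower bound for the means. -/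
theorem tvDist_cycleCounts_le (hℓ : ∀ i, 2 ≤ ℓ i) (hinj : ∀ i j, i ≠ j → ℓ i ≠ ℓ j) {M : ℝ}
    (hM : 1 ≤ M) (hμ : ∀ i, M ≤ cycleMean m n (ℓ i)) :
    tvDist ((law m n).map (fun ω => fun i : Fin r => cycleCount m n (ℓ i) ω))
      (Measure.pi fun i : Fin r => poissonMeasure (cycleMean m n (ℓ i))) ≤
      2 * throughConst m ℓ * (throughConst m ℓ + sharingConst m ℓ) * (4 + 2 * Real.log M) / M := by
  classical
  refine tvDist_counts_pi_poissonMeasure_le (law m n) (Γ := CycleIndex m n ℓ) Sigma.fst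
    (fun α => present α.2.1) (fun α => present_eq_zero_or_one _) _ (fun ω x => ?_)
    (p := fun α => presentProb α.2.1) (fun α => rfl) (N := neighbourhood) (fun α => ?_)
    (fun V _ _ α g hg => ?_) _ (fun i => cycleMean_eq_sum_law _) hM hμ ?_
  · rw [Fintype.sum_sigma]
    refine Finset.sum_congr rfl fun i _ => ?_
    rw [cycleCount_eq_sum, ← Finset.sum_coe_sort (cycles m n (ℓ i)) fun F => present F ω,
      Finset.sum_mul]
  · obtain ⟨k, v, e, -, h⟩ := exists_isCycleParam hℓ α
    exact mem_neighbourhood.2 ⟨e 0, h.mem 0, e 0, h.mem 0, rfl⟩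
  · refine sum_law_present_smul α.2.1 g fun ω ω' h => hg ω ω' fun β hβ => ?_
    refine present_congr fun y hy => h _ fun x hx hxy => hβ ?_
    exact mem_neighbourhood.2 ⟨x, hx, y, hy, hxy⟩
  · rw [← Finset.sum_add_distrib]
    calc _ ≤ ∑ α : CycleIndex m n ℓ,
          (throughConst m ℓ + sharingConst m ℓ) * (weight α.2.1 * invSum α.2.1) := by
          refine Finset.sum_le_sum fun α _ => ?_
          have h1 : ∑ β ∈ neighbourhood α, presentProb α.2.1 * presentProb β.2.1 ≤
              weight α.2.1 * (throughConst m ℓ * invSum α.2.1) := by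
            rw [← Finset.mul_sum]
            exact mul_le_mul (presentProb_le _) (sum_presentProb_neighbourhood_le hℓ α)
              (Finset.sum_nonneg fun β _ => presentProb_nonneg _) (weight_nonneg _)
          have h2 := sum_joint_present_le hℓ hinj α
          refine (add_le_add h1 h2).trans (le_of_eq ?_)
          ring
      _ ≤ (throughConst m ℓ + sharingConst m ℓ) * (2 * throughConst m ℓ) := by
          rw [← Finset.mul_sum]
          exact mul_le_mul_of_nonneg_left (sum_weight_mul_invSum_le hℓ)
            (add_nonneg (throughConst_nonneg m ℓ) (sharingConst_nonneg m ℓ))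
      _ = _ := by ring

/-- All the means are eventually at least a constant multiple of `log n`. -/
theorem exists_mul_log_le_cycleMean (hm : 2 ≤ m) (hℓ : ∀ i, 2 ≤ ℓ i) :
    ∃ c : ℝ, 0 < c ∧ c ≤ 1 ∧ ∀ᶠ n : ℕ in Filter.atTop, ∀ i, c * Real.log n ≤
      cycleMean m n (ℓ i) := by
  have hlog : Filter.Tendsto (fun n : ℕ => Real.log n) Filter.atTop Filter.atTop :=
    Real.tendsto_log_atTop.comp tendsto_natCast_atTop_atTop
  have h : ∀ i, ∃ c : ℝ, 0 < c ∧ ∀ᶠ n : ℕ in Filter.atTop, c * Real.log n ≤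
      cycleMean m n (ℓ i) := fun i => by
    obtain ⟨k, hk⟩ := Nat.exists_eq_add_of_le' (hℓ i)
    -- The factor `1 / 2` absorbs the additive loss `k + 1` once `log n ≥ 2 (k + 1)`.
    refine ⟨(1 / (2 * (k + 1) : ℝ)) ^ (k + 1) * (1 / 2), by positivity, ?_⟩
    filter_upwards [hlog.eventually_ge_atTop (2 * (k + 1 : ℝ)), Filter.eventually_ge_atTop 1]
      with n hn hn1
    rw [hk, mul_assoc]
    refine le_trans (mul_le_mul_of_nonneg_left ?_ (by positivity)) (log_le_cycleMean hm hn1 k)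
    linarith
  choose c hc0 hc using h
  have hfin : (Set.range c ∪ {1}).Finite := (Set.finite_range c).union (Set.finite_singleton 1)
  obtain ⟨a, ha, hmin⟩ := hfin.exists_minimal ⟨1, Or.inr rfl⟩
  have hle : ∀ b ∈ Set.range c ∪ {1}, a ≤ b := fun b hb => by
    rcases le_total a b with h | h
    exacts [h, hmin hb h]
  refine ⟨a, ?_, hle 1 (Or.inr rfl), ?_⟩
  · rcases ha with ⟨i, rfl⟩ | rfl
    exacts [hc0 i, one_pos]
  · filter_upwards [Filter.eventually_all.2 hc, Filter.eventually_ge_atTop 1] with n hn hn1 i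
    refine le_trans (mul_le_mul_of_nonneg_right (hle _ (Or.inl ⟨i, rfl⟩)) ?_) (hn i)
    exact Real.log_nonneg (by exact_mod_cast hn1)

end Approximation

end UniformAttachment

/-! ### From large `n` to all `n ≥ 3`, and conclusion. -/

theorem log_log_pos {n : ℕ} (hn : 3 ≤ n) : 0 < Real.log (Real.log n) := by
  refine Real.log_pos ?_
  rw [Real.lt_log_iff_exp_lt (by positivity)]
  exact Real.exp_one_lt_d9.trans_le (by
    have : (3 : ℝ) ≤ n := by exact_mod_cast hn
    linarith)

/-- A bounded sequence that is eventually `O(log log n / log n)` is so for all `n ≥ 3`. -/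
theorem exists_forall_le_log_log_div_log {d : ℕ → ℝ} (h1 : ∀ n, d n ≤ 1) {C : ℝ}
    (hC : ∀ᶠ n : ℕ in Filter.atTop, d n ≤ C * Real.log (Real.log n) / Real.log n) :
    ∃ C' : ℝ, 0 < C' ∧ ∀ n : ℕ, 3 ≤ n → d n ≤ C' * Real.log (Real.log n) / Real.log n := by
  obtain ⟨N, hN⟩ := Filter.eventually_atTop.1 hC
  have hpos : ∀ n : ℕ, 3 ≤ n → 0 < Real.log (Real.log n) / Real.log n := fun n hn =>
    div_pos (log_log_pos hn) (Real.log_pos (by exact_mod_cast (by omega : 1 < n)))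
  let S : ℝ := ∑ n ∈ Finset.range N, |Real.log n / Real.log (Real.log n)|
  have hS : 0 ≤ S := Finset.sum_nonneg fun _ _ => abs_nonneg _
  -- `S` dominates each of the finitely many ratios `log n / log log n` with `n < N`, where only the
  -- trivial bound `1` is used.
  refine ⟨|C| + S + 1, by positivity, fun n hn => ?_⟩
  have hp := hpos n hn
  rw [mul_div_assoc]
  by_cases hnN : N ≤ n
  · refine (hN n hnN).trans ?_
    rw [mul_div_assoc]
    refine mul_le_mul_of_nonneg_right ?_ hp.le
    linarith [le_abs_self C]
  · refine (h1 n).trans ?_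
    have hle : |Real.log n / Real.log (Real.log n)| ≤ S :=
      Finset.single_le_sum (f := fun n : ℕ => |Real.log n / Real.log (Real.log n)|)
        (fun _ _ => abs_nonneg _) (Finset.mem_range.2 (not_le.1 hnN))
    have e : Real.log n / Real.log (Real.log n) * (Real.log (Real.log n) / Real.log n) = 1 := by
      rw [div_mul_div_cancel₀ (log_log_pos hn).ne', div_self]
      exact (Real.log_pos (by exact_mod_cast (by omega : 1 < n))).ne'
    rw [← e]
    refine mul_le_mul_of_nonneg_right ?_ hp.le
    linarith [le_abs_self (Real.log n / Real.log (Real.log n)), abs_nonneg C]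

theorem theorem3p2 (m r : ℕ) (hm : 2 ≤ m) (hr : 2 ≤ r) (ℓ : Fin r → ℕ)
    (hℓ : ∀ i, 2 ≤ ℓ i) (hinj : ∀ i j, i ≠ j → ℓ i ≠ ℓ j) :
    ∃ C : ℝ, 0 < C ∧ ∀ n : ℕ, 3 ≤ n →
      tvDist
        ((UniformAttachment.law m n).map
          (fun ω => fun i : Fin r => UniformAttachment.cycleCount m n (ℓ i) ω))
        (Measure.pi fun i : Fin r => poissonMeasure (UniformAttachment.cycleMean m n (ℓ i)))
      ≤ C * Real.log (Real.log n) / Real.log n := by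
  obtain ⟨c, hc0, hc1, hmean⟩ := UniformAttachment.exists_mul_log_le_cycleMean hm hℓ
  set B := 2 * UniformAttachment.throughConst m ℓ *
    (UniformAttachment.throughConst m ℓ + UniformAttachment.sharingConst m ℓ)
  have hB : 0 ≤ B := mul_nonneg (mul_nonneg zero_le_two (UniformAttachment.throughConst_nonneg m ℓ))
    (add_nonneg (UniformAttachment.throughConst_nonneg m ℓ)
      (UniformAttachment.sharingConst_nonneg m ℓ))
  have hlog : Filter.Tendsto (fun n : ℕ => Real.log n) Filter.atTop Filter.atTop :=
    Real.tendsto_log_atTop.comp tendsto_natCast_atTop_atTop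
  -- With `M = c log n`, `c ≤ 1` and `log log n ≥ 1`, the factor `4 + 2 log M` is at most `6 log log
  -- n`.
  refine exists_forall_le_log_log_div_log (C := B * 6 / c) (fun n => ?_) ?_
  · have : IsProbabilityMeasure ((UniformAttachment.law m n).map
        (fun ω => fun i : Fin r => UniformAttachment.cycleCount m n (ℓ i) ω)) :=
      Measure.isProbabilityMeasure_map (measurable_of_finite _).aemeasurable
    exact tvDist_le_one _ _
  · filter_upwards [hmean, hlog.eventually_ge_atTop (1 / c),
      (Real.tendsto_log_atTop.comp hlog).eventually_ge_atTop 1, hlog.eventually_gt_atTop 0]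
      with n hn hn1 hn2 hn3
    have hM : 1 ≤ c * Real.log n := by
      rw [div_le_iff₀ hc0] at hn1
      linarith
    refine (UniformAttachment.tvDist_cycleCounts_le hℓ hinj hM hn).trans ?_
    have hn2' : 1 ≤ Real.log (Real.log n) := hn2
    have hlogM : Real.log (c * Real.log n) ≤ Real.log (Real.log n) :=
      Real.log_le_log (by linarith) (mul_le_of_le_one_left hn3.le hc1)
    calc B * (4 + 2 * Real.log (c * Real.log n)) / (c * Real.log n) ≤
          B * (6 * Real.log (Real.log n)) / (c * Real.log n) := by
          gcongr
          linarith
      _ = _ := by field_simp
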